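/- Throughout, $\log$ denotes the logarithm to base $2$, $\mathbb{N}=\{1,2,\dots\}$, $[N]=\{1,\dots,N\}$, and $\binom{A}{k}$ is the set of all $k$-element subsets of a set $A$. Let $d\ge 2$ be an integer. For $n\in\mathbb{N}$ and $S\in\binom{\mathbb{Z}^d}{n^d}$ put $$F_n(S)=\min\{\operatorname{Lip}(f)\colon f\colon S\to\{1,\dots,n\}^d\text{ surjective}\},$$ where $\operatorname{Lip}(f)$ is the least Lipschitz constant of $f$ with respect to the Euclidean norm. Let $(c_n)_{n\in\mathbb{N}}$ be a sequence of real numbers with $c_1\ge 1$ and $c_n\ge\left(1+\frac{2^{d+7}}{\log n}\right)^{1/d}$ for all $n\ge 2$, and let $q\in\mathbb{R}$ with $q\ge 1$ and $q>3/d$. Let $$\mathcal{G}=\prod_{n=1}^{\infty}\binom{[\lfloor c_n n\rfloor]^d}{n^d}$$ be equipped with the product $\mathbb{P}$ of the uniform probability measures on its (finite, non-empty) factors; that is, a random $(S_n)_{n\in\mathbb{N}}\in\mathcal{G}$ consists of independent sets $S_n$, each chosen uniformly among the $n^d$-element subsets of $\{1,\dots,\lfloor c_n n\rfloor\}^d$.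 Then $$\mathbb{P}\left[\limsup_{n\to\infty}F_n(S_n)(\log n)^{-q}<\infty\right]=1.$$ -/

import Mathlib

open Filter MeasureTheory ProbabilityTheory

noncomputable section

namespace RandomGrid

/-- The point of Euclidean space `ℝ^d` given by a point of the integer lattice `ℤ^d`. -/
def toEuclidean {d : ℕ} (x : Fin d → ℤ) : EuclideanSpace ℝ (Fin d) :=
  WithLp.toLp 2 fun i => (x i : ℝ)

/-- The grid `[N]^d = {1, …, N}^d` in the integer lattice. -/
def grid (d N : ℕ) : Finset (Fin d → ℤ) :=
  Fintype.piFinset fun _ => Finset.Icc 1 (N : ℤ)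

/-- `L ≥ 0` is a Lipschitz constant of `f`, with respect to the Euclidean norm on both sides. -/
def IsLipConst {d : ℕ} {S T : Finset (Fin d → ℤ)} (f : S → T) (L : ℝ) : Prop :=
  0 ≤ L ∧ ∀ x y : S, dist (toEuclidean (f x).1) (toEuclidean (f y).1) ≤
    L * dist (toEuclidean x.1) (toEuclidean y.1)

/-- `Lip f`, the least Lipschitz constant of a map between finite sets of lattice points. -/
def lip {d : ℕ} {S T : Finset (Fin d → ℤ)} (f : S → T) : ℝ :=
  sInf {L : ℝ | IsLipConst f L}

/-- `F_n(S)`, the minimum of `Lip f` over all surjections `f : S → {1, …, n}^d`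
(for `S ⊆ ℤ^d` with `n ^ d` elements, so that the minimum exists). -/
def bestLip (d n : ℕ) (S : Finset (Fin d → ℤ)) : ℝ :=
  sInf {L : ℝ | ∃ f : S → grid d n, Function.Surjective f ∧ L = lip f}

/-- The set of all `n ^ d`-element subsets of the grid `{1, …, N}^d`. -/
def Config (d N n : ℕ) : Type :=
  {S : Finset (Fin d → ℤ) // S ∈ (grid d N).powersetCard (n ^ d)}

instance (d N n : ℕ) : Finite (Config d N n) :=
  inferInstanceAs (Finite {S : Finset (Fin d → ℤ) // S ∈ (grid d N).powersetCard (n ^ d)})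

/-- Every set of configurations is an event. -/
instance (d N n : ℕ) : MeasurableSpace (Config d N n) := ⊤

/-- The sequence space `∏_{n ≥ 1} binom([⌊c_n n⌋]^d, n^d)`. -/
abbrev SeqSpace (d : ℕ) (c : ℕ+ → ℝ) : Type :=
  (n : ℕ+) → Config d ⌊c n * ((n : ℕ) : ℝ)⌋₊ n

/-- The product of the uniform probability measures on the factors of the sequence space. -/
def seqMeasure (d : ℕ) (c : ℕ+ → ℝ) : Measure (SeqSpace d c) :=
  Measure.infinitePi fun n : ℕ+ =>
    (uniformOn Set.univ : Measure (Config d ⌊c n * ((n : ℕ) : ℝ)⌋₊ n))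

theorem card_grid (d N : ℕ) : (grid d N).card = N ^ d := by
  simp [grid]

theorem toEuclidean_injective {d : ℕ} : Function.Injective (toEuclidean (d := d)) := by
  intro x y h
  funext i
  have h1 : (toEuclidean x) i = (toEuclidean y) i := by rw [h]
  simpa [toEuclidean] using h1

/-- `lip f` is itself a Lipschitz constant, and the least one. -/
theorem isLeast_lip {d : ℕ} {S T : Finset (Fin d → ℤ)} (f : S → T) :
    IsLeast {L : ℝ | IsLipConst f L} (lip f) := by
  have hb : BddBelow {L : ℝ | IsLipConst f L} := ⟨0, fun L hL => hL.1⟩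
  have hc : IsClosed {L : ℝ | IsLipConst f L} := by
    have : {L : ℝ | IsLipConst f L} = Set.Ici 0 ∩ ⋂ x : S, ⋂ y : S,
        {L : ℝ | dist (toEuclidean (f x).1) (toEuclidean (f y).1) ≤
          L * dist (toEuclidean x.1) (toEuclidean y.1)} := by
      ext L; simp [IsLipConst]
    rw [this]
    refine isClosed_Ici.inter (isClosed_iInter fun x => isClosed_iInter fun y => ?_)
    exact isClosed_le continuous_const (by fun_prop)
  have hn : {L : ℝ | IsLipConst f L}.Nonempty := by
    let r : S × S → ℝ := fun p => dist (toEuclidean (f p.1).1) (toEuclidean (f p.2).1) /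
      dist (toEuclidean p.1.1) (toEuclidean p.2.1)
    have hr : ∀ p, 0 ≤ r p := fun p => by positivity
    refine ⟨∑ p, r p, Finset.sum_nonneg fun p _ => hr p, fun x y => ?_⟩
    by_cases hxy : x = y
    · subst hxy; simp
    · have hpos : 0 < dist (toEuclidean x.1) (toEuclidean y.1) := by
        rw [dist_pos]
        exact fun h => hxy (Subtype.ext (toEuclidean_injective h))
      have hsum : r (x, y) ≤ ∑ p, r p :=
        Finset.single_le_sum (fun p _ => hr p) (Finset.mem_univ (x, y))
      generalize (∑ p, r p) = R at hsum ⊢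
      exact (div_le_iff₀ hpos).1 hsum
  exact ⟨hc.csInf_mem hn hb, fun L hL => csInf_le hb hL⟩

/-- For a set of `n ^ d` lattice points, `bestLip d n S` is the minimum of `Lip f` over
surjections. -/
theorem isLeast_bestLip {d n : ℕ} {S : Finset (Fin d → ℤ)} (hS : S.card = n ^ d) :
    IsLeast {L : ℝ | ∃ f : S → grid d n, Function.Surjective f ∧ L = lip f}
      (bestLip d n S) := by
  have hfin : {L : ℝ | ∃ f : S → grid d n, Function.Surjective f ∧ L = lip f}.Finite :=
    (Set.finite_range fun f : S → grid d n => lip f).subset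
      fun L ⟨f, _, h⟩ => ⟨f, h.symm⟩
  have hne : {L : ℝ | ∃ f : S → grid d n, Function.Surjective f ∧ L = lip f}.Nonempty := by
    have e : S ≃ grid d n := Finset.equivOfCardEq (hS.trans (card_grid d n).symm)
    exact ⟨lip e, e, e.surjective, rfl⟩
  exact ⟨hne.csInf_mem hfin, fun L hL => csInf_le hfin.bddBelow hL⟩

/-- The sequence space carries a probability measure as soon as all `c_n ≥ 1`. -/
theorem isProbabilityMeasure_seqMeasure (d : ℕ) (c : ℕ+ → ℝ) (hc : ∀ n, 1 ≤ c n) :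
    IsProbabilityMeasure (seqMeasure d c) := by
  have h : ∀ n : ℕ+, Nonempty (Config d ⌊c n * ((n : ℕ) : ℝ)⌋₊ n) := by
    intro n
    have hle : (n : ℕ) ^ d ≤ (grid d ⌊c n * ((n : ℕ) : ℝ)⌋₊).card := by
      rw [card_grid]
      refine Nat.pow_le_pow_left (Nat.le_floor ?_) d
      exact le_mul_of_one_le_left (by positivity) (hc n)
    obtain ⟨S, hS⟩ := Finset.powersetCard_nonempty.2 hle
    exact ⟨⟨S, hS⟩⟩
  unfold seqMeasure
  infer_instance

end RandomGrid

end

namespace RandomGrid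

/-! Put N = ⌊c_n n⌋, Λ = log n (natural) and h = Λ^q. Cut [N]^d into n^d cells of side N/n; the map
sending a point to the index of its cell does not increase coordinate distances, as n ≤ N, and a
cell holds about one point of S on average. If the cell counts can be moved to the uniform
distribution on [n]^d with displacement at most D, Hall's theorem yields a bijection from S to [n]^d
within D of the cell map. Distinct lattice points are at distance at least 1, so its Lipschitz
constant is at most d(2D + 1) (`bestLip_le_of_transports`). The task is to get D = O(h).

The probabilistic input is a Chernoff bound for the hypergeometric law (`card_filter_deviation_le`).
With a union bound over boxes it shows that, off an event of probability O(n⁻²), every box of cells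
with sides longer than h has a count within 2√(κΛM) of its mean M (`IsBalanced`,
`card_not_isBalanced_le`). Borel–Cantelli then gives balance for all large n, almost surely.

The deterministic input is multiscale (`transports_spread_of_splits`). Boxes are repeatedly bisected
across a longest side, down to sides O(h), and the uniform density is restored from the leaves up.
Merging two halves of a box with longest side L displaces mass by O(1 + L√(Λ/M)). Boxes stay fat and
d ≥ 2, so M is at least of order h^(d-2) L²; the factor L cancels, and h^d ≥ Λ³ leaves O(1 + h/Λ)
(`IsBalanced.split`). There are O(Λ) levels, so the total is O(Λ + h) = O(h). The assumption q > 3/d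
provides Λ³ ≤ h^d, and q ≥ 1 provides Λ ≤ h. -/

/-! ### Tail bounds for the hypergeometric distribution -/

/-- The ratio of the two binomial coefficients is the product of (k - i)/(M - i) over i < z, and
each factor is at most k/M. It is the probability that a random k-subset contains z given points. -/
theorem choose_sub_mul_pow_le {M k z : ℕ} (hk : k ≤ M) (hz : z ≤ k) :
    (M - z).choose (k - z) * M ^ z ≤ k ^ z * M.choose k := by
  induction z with
  | zero => simp
  | succ z ih =>
    have ih := ih (by omega)
    obtain ⟨a, ha⟩ : ∃ a, M - z = a + 1 := ⟨M - z - 1, by omega⟩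
    obtain ⟨b, hb⟩ : ∃ b, k - z = b + 1 := ⟨k - z - 1, by omega⟩
    have ha' : M - (z + 1) = a := by omega
    have hb' : k - (z + 1) = b := by omega
    rw [ha', hb']
    rw [ha, hb] at ih
    have h1 := Nat.add_one_mul_choose_eq a b
    have h2 : (b + 1) * M ≤ k * (a + 1) := by
      have h3 : M = a + 1 + z := by omega
      have h4 : k = b + 1 + z := by omega
      have : b ≤ a := by omega
      rw [h3, h4]; nlinarith
    refine Nat.le_of_mul_le_mul_left ?_ (Nat.succ_pos a)
    calc (a + 1) * (a.choose b * M ^ (z + 1))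
        = ((a + 1) * a.choose b) * M ^ z * M := by ring
      _ = ((b + 1) * M) * ((a + 1).choose (b + 1) * M ^ z) := by rw [h1]; ring
      _ ≤ (k * (a + 1)) * (k ^ z * M.choose k) := Nat.mul_le_mul h2 ih
      _ = (a + 1) * (k ^ (z + 1) * M.choose k) := by ring

section Hypergeometric

variable {α : Type*} [DecidableEq α]

theorem card_powersetCard_superset_le (X Z : Finset α) (k : ℕ) (hZ : Z ⊆ X) :
    ((X.powersetCard k).filter (Z ⊆ ·)).card ≤ (X.card - Z.card).choose (k - Z.card) := by
  rw [← Finset.card_sdiff_of_subset hZ, ← Finset.card_powersetCard]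
  refine Finset.card_le_card_of_injOn (· \ Z) ?_ ?_
  · intro S hS
    rw [Finset.mem_coe, Finset.mem_filter, Finset.mem_powersetCard] at hS
    rw [Finset.mem_coe, Finset.mem_powersetCard]
    refine ⟨Finset.sdiff_subset_sdiff hS.1.1 le_rfl, ?_⟩
    rw [Finset.card_sdiff_of_subset hS.2, hS.1.2]
  · intro S hS T hT h
    rw [Finset.mem_coe, Finset.mem_filter] at hS hT
    rw [← Finset.sdiff_union_of_subset hS.2, ← Finset.sdiff_union_of_subset hT.2]
    simp only at h
    rw [h]

theorem card_powersetCard_superset_le_mul (X Z : Finset α) {k : ℕ} (hZ : Z ⊆ X) (hk : k ≤ X.card) :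
    (((X.powersetCard k).filter (Z ⊆ ·)).card : ℝ) ≤
      X.card.choose k * ((k : ℝ) / X.card) ^ Z.card := by
  rcases Nat.eq_zero_or_pos X.card with h0 | h0
  · have : Z = ∅ := by
      rw [Finset.card_eq_zero] at h0; subst h0; exact Finset.subset_empty.1 hZ
    subst this
    simp
  by_cases hz : Z.card ≤ k
  · have h1 := choose_sub_mul_pow_le hk hz
    have h2 := card_powersetCard_superset_le X Z k hZ
    rw [div_pow, mul_div_assoc', le_div_iff₀ (by positivity)]
    calc (((X.powersetCard k).filter (Z ⊆ ·)).card : ℝ) * (X.card : ℝ) ^ Z.card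
        ≤ ((X.card - Z.card).choose (k - Z.card) : ℕ) * (X.card : ℝ) ^ Z.card := by gcongr
      _ ≤ ((k ^ Z.card * X.card.choose k : ℕ) : ℝ) := by exact_mod_cast h1
      _ = _ := by push_cast; ring
  · have : (X.powersetCard k).filter (Z ⊆ ·) = ∅ := by
      refine Finset.filter_eq_empty_iff.2 fun S hS h => hz ?_
      rw [← (Finset.mem_powersetCard.1 hS).2]
      exact Finset.card_le_card h
    rw [this]
    simp only [Finset.card_empty, Nat.cast_zero]
    positivity

/-- Expand (1 + s)^|S ∩ Y| over subsets Z of S ∩ Y and exchange the sums. As s ≥ 0, each term is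
bounded by treating the inclusions of the points of Z as independent. -/
theorem sum_one_add_pow_card_inter_le (X Y : Finset α) {k : ℕ} (hY : Y ⊆ X) (hk : k ≤ X.card)
    {s : ℝ} (hs : 0 ≤ s) :
    ∑ S ∈ X.powersetCard k, (1 + s) ^ (S ∩ Y).card ≤
      X.card.choose k * (1 + (k : ℝ) / X.card * s) ^ Y.card := by
  have hexp : ∀ (W : Finset α) (r : ℝ), (1 + r) ^ W.card = ∑ Z ∈ W.powerset, r ^ Z.card := by
    intro W r
    have := Finset.prod_one_add (f := fun _ : α => r) W
    simpa using this
  calc ∑ S ∈ X.powersetCard k, (1 + s) ^ (S ∩ Y).card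
      = ∑ S ∈ X.powersetCard k, ∑ Z ∈ Y.powerset, if Z ⊆ S then s ^ Z.card else 0 := by
        refine Finset.sum_congr rfl fun S _ => ?_
        rw [hexp, ← Finset.sum_filter]
        refine Finset.sum_congr ?_ fun _ _ => rfl
        ext Z
        simp only [Finset.mem_powerset, Finset.mem_filter, Finset.subset_inter_iff]
        tauto
    _ = ∑ Z ∈ Y.powerset, (((X.powersetCard k).filter (Z ⊆ ·)).card : ℝ) * s ^ Z.card := by
        rw [Finset.sum_comm]
        refine Finset.sum_congr rfl fun Z _ => ?_
        rw [← Finset.sum_filter, Finset.sum_const, nsmul_eq_mul]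
    _ ≤ ∑ Z ∈ Y.powerset, (X.card.choose k * ((k : ℝ) / X.card) ^ Z.card) * s ^ Z.card := by
        refine Finset.sum_le_sum fun Z hZ => ?_
        have := card_powersetCard_superset_le_mul X Z
          ((Finset.mem_powerset.1 hZ).trans hY) hk
        gcongr
    _ = X.card.choose k * (1 + (k : ℝ) / X.card * s) ^ Y.card := by
        rw [hexp, Finset.mul_sum]
        refine Finset.sum_congr rfl fun Z _ => ?_
        rw [mul_pow]; ring

/-- The generating function of the number of hits of `Y` by a uniform random `k`-subset of `X`
is dominated by that of a binomial random variable. -/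
theorem sum_pow_card_inter_le (X Y : Finset α) {k : ℕ} (hY : Y ⊆ X) (hk : k ≤ X.card)
    (hX : 0 < X.card) {z : ℝ} (hz : 0 < z) :
    ∑ S ∈ X.powersetCard k, z ^ (S ∩ Y).card ≤
      X.card.choose k * (1 + (k : ℝ) / X.card * (z - 1)) ^ Y.card := by
  rcases le_total 1 z with h1 | h1
  · have := sum_one_add_pow_card_inter_le X Y hY hk (s := z - 1) (by linarith)
    simpa using this
  -- For z < 1 the expansion would have negative coefficients. Passing to the complement of S
  -- replaces z by 1/z ≥ 1, because |S ∩ Y| + |Y \ S| = |Y|.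
  · have hX' : (X.card : ℝ) ≠ 0 := by positivity
    have h2 := sum_one_add_pow_card_inter_le X Y hY (Nat.sub_le X.card k) (s := z⁻¹ - 1)
      (by have := (one_le_inv₀ hz).2 h1; linarith)
    rw [Nat.choose_symm hk] at h2
    have h3 : ∑ S ∈ X.powersetCard k, z ^ (S ∩ Y).card =
        z ^ Y.card * ∑ S ∈ X.powersetCard (X.card - k), (1 + (z⁻¹ - 1)) ^ (S ∩ Y).card := by
      rw [Finset.mul_sum]
      refine Finset.sum_bij' (fun S _ => X \ S) (fun S _ => X \ S) ?_ ?_ ?_ ?_ ?_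
      · intro S hS
        rw [Finset.mem_powersetCard] at hS ⊢
        exact ⟨Finset.sdiff_subset, by rw [Finset.card_sdiff_of_subset hS.1, hS.2]⟩
      · intro S hS
        rw [Finset.mem_powersetCard] at hS ⊢
        exact ⟨Finset.sdiff_subset, by rw [Finset.card_sdiff_of_subset hS.1, hS.2]; omega⟩
      · intro S hS
        exact Finset.sdiff_sdiff_eq_self (Finset.mem_powersetCard.1 hS).1
      · intro S hS
        exact Finset.sdiff_sdiff_eq_self (Finset.mem_powersetCard.1 hS).1
      · intro S hS
        have h4 : (S ∩ Y).card + ((X \ S) ∩ Y).card = Y.card := by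
          rw [← Finset.card_union_of_disjoint]
          · congr 1
            ext x
            simp only [Finset.mem_union, Finset.mem_inter, Finset.mem_sdiff]
            have := @hY x
            tauto
          · rw [Finset.disjoint_left]
            intro x
            simp only [Finset.mem_inter, Finset.mem_sdiff]
            tauto
        rw [← h4, pow_add, add_sub_cancel, inv_pow, mul_assoc, mul_inv_cancel₀ (by positivity),
          mul_one]
    rw [h3]
    calc _ ≤ z ^ Y.card * (X.card.choose k *
          (1 + ((X.card - k : ℕ) : ℝ) / X.card * (z⁻¹ - 1)) ^ Y.card) := by gcongr
      _ = X.card.choose k * (z * (1 + ((X.card - k : ℕ) : ℝ) / X.card * (z⁻¹ - 1))) ^ Y.card := by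
        rw [mul_pow]; ring
      _ = _ := by
        congr 2
        rw [Nat.cast_sub hk]
        field_simp
        ring

theorem sum_exp_card_inter_le (X Y : Finset α) {k : ℕ} (hY : Y ⊆ X) (hk : k ≤ X.card)
    (hX : 0 < X.card) {θ : ℝ} (hθ : |θ| ≤ 1) :
    ∑ S ∈ X.powersetCard k, Real.exp (θ * (S ∩ Y).card) ≤
      X.card.choose k * Real.exp ((k : ℝ) / X.card * Y.card * (θ + θ ^ 2)) := by
  have h := sum_pow_card_inter_le X Y hY hk hX (Real.exp_pos θ)
  have hr0 : (0 : ℝ) ≤ (k : ℝ) / X.card := by positivity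
  have hr1 : (k : ℝ) / X.card ≤ 1 := div_le_one_of_le₀ (by exact_mod_cast hk) (by positivity)
  set r : ℝ := (k : ℝ) / X.card
  have hexp := Real.exp_pos θ
  have h0 : 0 ≤ 1 + r * (Real.exp θ - 1) := by nlinarith
  have hle : 1 + r * (Real.exp θ - 1) ≤ Real.exp (r * (θ + θ ^ 2)) := by
    have h1 := (abs_le.1 (Real.abs_exp_sub_one_sub_id_le hθ)).2
    have h2 := Real.add_one_le_exp (r * (θ + θ ^ 2))
    nlinarith
  calc ∑ S ∈ X.powersetCard k, Real.exp (θ * (S ∩ Y).card)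
      = ∑ S ∈ X.powersetCard k, Real.exp θ ^ (S ∩ Y).card := by
        refine Finset.sum_congr rfl fun S _ => ?_
        rw [mul_comm, Real.exp_nat_mul]
    _ ≤ _ := h
    _ ≤ X.card.choose k * (Real.exp (r * (θ + θ ^ 2))) ^ Y.card := by gcongr
    _ = _ := by rw [← Real.exp_nat_mul]; congr 2; ring

/-- Chernoff's bound for the hypergeometric distribution. -/
theorem card_filter_deviation_le (X Y : Finset α) {k : ℕ} (hY : Y ⊆ X) (hk : k ≤ X.card)
    (hX : 0 < X.card) {m t : ℝ} (hm : m = (k : ℝ) / X.card * Y.card) (hm0 : 0 < m) (ht : 0 ≤ t)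
    (htm : t ≤ 2 * m) :
    (((X.powersetCard k).filter fun S => t ≤ |((S ∩ Y).card : ℝ) - m|).card : ℝ) ≤
      2 * Real.exp (-(t ^ 2 / (4 * m))) * X.card.choose k := by
  -- Both tails at once, with θ = ± t/(2m), the minimiser of mθ² - |θ|t; the minimum is -t²/(4m).
  -- The assumption t ≤ 2m is what gives |θ| ≤ 1.
  have key : ∀ θ : ℝ, |θ| ≤ 1 → θ ^ 2 = (t / (2 * m)) ^ 2 →
      (((X.powersetCard k).filter fun S => |θ| * t ≤ θ * (((S ∩ Y).card : ℝ) - m)).card : ℝ) ≤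
      Real.exp (-(t ^ 2 / (4 * m))) * X.card.choose k := by
    intro θ hθ hθ2
    have h1 := sum_exp_card_inter_le X Y hY hk hX hθ
    rw [← hm] at h1
    have habs : |θ| = t / (2 * m) := by
      rw [← Real.sqrt_sq_eq_abs, hθ2, Real.sqrt_sq (by positivity)]
    have h2 : (((X.powersetCard k).filter fun S =>
        |θ| * t ≤ θ * (((S ∩ Y).card : ℝ) - m)).card : ℝ) * Real.exp (|θ| * t + θ * m) ≤
        ∑ S ∈ X.powersetCard k, Real.exp (θ * (S ∩ Y).card) := by
      rw [← nsmul_eq_mul, ← Finset.sum_const]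
      refine (Finset.sum_le_sum (fun S hS => ?_)).trans
        (Finset.sum_le_sum_of_subset_of_nonneg (Finset.filter_subset _ _)
          fun _ _ _ => (Real.exp_pos _).le)
      refine Real.exp_le_exp.2 ?_
      have := (Finset.mem_filter.1 hS).2
      linarith
    rw [← le_div_iff₀ (Real.exp_pos _)] at h2
    refine h2.trans ?_
    rw [div_le_iff₀ (Real.exp_pos _)]
    refine h1.trans (le_of_eq ?_)
    rw [mul_comm, mul_right_comm, ← Real.exp_add]
    congr 2
    rw [habs, mul_add, hθ2]
    field_simp
    ring
  have hq : |t / (2 * m)| ≤ 1 := by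
    rw [abs_of_nonneg (by positivity)]
    exact div_le_one_of_le₀ htm (by positivity)
  have hq0 : 0 ≤ t / (2 * m) := by positivity
  rcases ht.eq_or_lt with ht0 | ht0
  · have : (((X.powersetCard k).filter fun S => t ≤ |((S ∩ Y).card : ℝ) - m|).card : ℝ) ≤
        X.card.choose k := by
      rw [← Finset.card_powersetCard]
      exact_mod_cast Finset.card_filter_le _ _
    rw [← ht0]
    simp only [ne_eq, OfNat.ofNat_ne_zero, not_false_eq_true, zero_pow, zero_div, neg_zero,
      Real.exp_zero, mul_one]
    rw [← ht0] at this
    have h0 : (0 : ℝ) ≤ X.card.choose k := by positivity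
    linarith
  have hqp : 0 < t / (2 * m) := by positivity
  have k1 := key (t / (2 * m)) hq rfl
  have k2 := key (-(t / (2 * m))) (by rwa [abs_neg]) (by ring)
  rw [abs_neg] at k2
  rw [abs_of_nonneg hq0] at k1 k2
  have hsub : ((X.powersetCard k).filter fun S => t ≤ |((S ∩ Y).card : ℝ) - m|) ⊆
      ((X.powersetCard k).filter fun S =>
        t / (2 * m) * t ≤ t / (2 * m) * (((S ∩ Y).card : ℝ) - m)) ∪
      ((X.powersetCard k).filter fun S =>
        t / (2 * m) * t ≤ -(t / (2 * m)) * (((S ∩ Y).card : ℝ) - m)) := by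
    intro S hS
    rw [Finset.mem_union, Finset.mem_filter, Finset.mem_filter]
    rw [Finset.mem_filter, le_abs'] at hS
    rcases hS with ⟨hS, h | h⟩
    · exact Or.inr ⟨hS, by nlinarith⟩
    · exact Or.inl ⟨hS, by nlinarith⟩
  have hc := (Finset.card_le_card hsub).trans (Finset.card_union_le _ _)
  have hc' : (((X.powersetCard k).filter fun S => t ≤ |((S ∩ Y).card : ℝ) - m|).card : ℝ) ≤ _ :=
    (Nat.cast_le (α := ℝ)).2 hc
  rw [Nat.cast_add] at hc'
  linarith

end Hypergeometric

/-! ### Lattice boxes and their bisection -/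

variable {d : ℕ}

/-- The lattice box `∏ (a i, b i]`. -/
noncomputable def box (a b : Fin d → ℤ) : Finset (Fin d → ℤ) :=
  Fintype.piFinset fun i => Finset.Ioc (a i) (b i)

theorem mem_box {a b x : Fin d → ℤ} : x ∈ box a b ↔ ∀ i, a i < x i ∧ x i ≤ b i := by
  simp [box]

theorem card_box {a b : Fin d → ℤ} (h : ∀ i, a i ≤ b i) :
    ((box a b).card : ℝ) = ∏ i, ((b i : ℝ) - a i) := by
  simp only [box, Fintype.card_piFinset, Int.card_Ioc, Nat.cast_prod]
  refine Finset.prod_congr rfl fun i _ => ?_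
  have : (((b i - a i).toNat : ℤ) : ℝ) = ((b i - a i : ℤ) : ℝ) := by
    rw [Int.toNat_of_nonneg (by linarith [h i])]
  push_cast at this
  exact this

theorem card_box_update_right {a b : Fin d → ℤ} (h : ∀ i, a i ≤ b i) {i : Fin d} {m : ℤ}
    (hm : a i ≤ m) :
    ((box a (Function.update b i m)).card : ℝ) * ((b i : ℝ) - a i) =
      (box a b).card * ((m : ℝ) - a i) := by
  rw [card_box h, card_box (fun j => by by_cases hj : j = i <;> [subst hj; skip] <;> simp [*]),
    ← Finset.mul_prod_erase _ _ (Finset.mem_univ i), ← Finset.mul_prod_erase _ _ (Finset.mem_univ i)]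
  rw [Finset.prod_congr rfl (g := fun j => ((b j : ℝ) - a j))
    (fun j hj => by rw [Function.update_of_ne (Finset.ne_of_mem_erase hj)])]
  rw [Function.update_self]
  ring

theorem card_box_update_left {a b : Fin d → ℤ} (h : ∀ i, a i ≤ b i) {i : Fin d} {m : ℤ}
    (hm : m ≤ b i) :
    ((box (Function.update a i m) b).card : ℝ) * ((b i : ℝ) - a i) =
      (box a b).card * ((b i : ℝ) - m) := by
  rw [card_box h, card_box (fun j => by by_cases hj : j = i <;> [subst hj; skip] <;> simp [*]),
    ← Finset.mul_prod_erase _ _ (Finset.mem_univ i), ← Finset.mul_prod_erase _ _ (Finset.mem_univ i)]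
  rw [Finset.prod_congr rfl (g := fun j => ((b j : ℝ) - a j))
    (fun j hj => by rw [Function.update_of_ne (Finset.ne_of_mem_erase hj)])]
  rw [Function.update_self]
  ring

theorem box_update_disjoint (a b : Fin d → ℤ) (i : Fin d) (m : ℤ) :
    Disjoint (box a (Function.update b i m)) (box (Function.update a i m) b) := by
  rw [Finset.disjoint_left]
  intro x hx hy
  have h1 := (mem_box.1 hx i).2
  have h2 := (mem_box.1 hy i).1
  rw [Function.update_self] at h1 h2
  omega

theorem box_update_union {a b : Fin d → ℤ} {i : Fin d} {m : ℤ} (h1 : a i ≤ m) (h2 : m ≤ b i) :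
    box a (Function.update b i m) ∪ box (Function.update a i m) b = box a b := by
  ext x
  simp only [Finset.mem_union, mem_box]
  constructor
  · rintro (h | h) j
    · have := h j
      by_cases hj : j = i
      · subst hj; rw [Function.update_self] at this; omega
      · rwa [Function.update_of_ne hj] at this
    · have := h j
      by_cases hj : j = i
      · subst hj; rw [Function.update_self] at this; omega
      · rwa [Function.update_of_ne hj] at this
  · intro h
    rcases le_or_gt (x i) m with hx | hx
    · left
      intro j
      by_cases hj : j = i
      · subst hj; rw [Function.update_self]; exact ⟨(h j).1, hx⟩
      · rw [Function.update_of_ne hj]; exact h j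
    · right
      intro j
      by_cases hj : j = i
      · subst hj; rw [Function.update_self]; exact ⟨hx, (h j).2⟩
      · rw [Function.update_of_ne hj]; exact h j

/-! ### Transport of mass with bounded displacement -/

/-- The set of lattice points at sup-distance at most `D` from `A`. -/
noncomputable def nbhd (D : ℕ) (A : Finset (Fin d → ℤ)) : Finset (Fin d → ℤ) :=
  A.biUnion fun x => Fintype.piFinset fun i => Finset.Icc (x i - D) (x i + D)

theorem mem_nbhd {D : ℕ} {A : Finset (Fin d → ℤ)} {y : Fin d → ℤ} :
    y ∈ nbhd D A ↔ ∃ x ∈ A, ∀ i, x i - D ≤ y i ∧ y i ≤ x i + D := by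
  simp [nbhd]

/-- The mass `μ` can be moved into `ν` with displacement at most `D`, in the form of
Hall's condition. -/
def Transports (D : ℕ) (μ ν : (Fin d → ℤ) → ℝ) : Prop :=
  ∀ A : Finset (Fin d → ℤ), ∑ x ∈ A, μ x ≤ ∑ y ∈ nbhd D A, ν y

theorem Transports.mono {D E : ℕ} {μ ν : (Fin d → ℤ) → ℝ} (h : Transports D μ ν) (hDE : D ≤ E)
    (hν : ∀ x, 0 ≤ ν x) : Transports E μ ν := by
  intro A
  refine (h A).trans (Finset.sum_le_sum_of_subset_of_nonneg ?_ fun x _ _ => hν x)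
  intro y hy
  obtain ⟨x, hx, h⟩ := mem_nbhd.1 hy
  exact mem_nbhd.2 ⟨x, hx, fun i => by have := h i; omega⟩

/-- Hall's condition composes because the E-neighbourhood of a D-neighbourhood lies in the (D +
E)-neighbourhood. Displacements of successive scales therefore add up without any coupling being
constructed. -/
theorem Transports.trans {D E : ℕ} {μ ν τ : (Fin d → ℤ) → ℝ} (h : Transports D μ ν)
    (h' : Transports E ν τ) (hτ : ∀ x, 0 ≤ τ x) : Transports (D + E) μ τ := by
  intro A
  refine ((h A).trans (h' _)).trans (Finset.sum_le_sum_of_subset_of_nonneg ?_ fun x _ _ => hτ x)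
  intro y hy
  obtain ⟨x, hx, h⟩ := mem_nbhd.1 hy
  obtain ⟨w, hw, h'⟩ := mem_nbhd.1 hx
  exact mem_nbhd.2 ⟨w, hw, fun i => by have := h i; have := h' i; push_cast; omega⟩

theorem Transports.add {D : ℕ} {μ ν μ' ν' : (Fin d → ℤ) → ℝ} (h : Transports D μ ν)
    (h' : Transports D μ' ν') : Transports D (fun x => μ x + μ' x) (fun x => ν x + ν' x) := by
  intro A
  simp only [Finset.sum_add_distrib]
  exact add_le_add (h A) (h' A)

/-- The mass that `g` puts on `T`, spread uniformly over `T`. -/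
noncomputable def spread (g : (Fin d → ℤ) → ℝ) (T : Finset (Fin d → ℤ)) (x : Fin d → ℤ) : ℝ :=
  if x ∈ T then (∑ y ∈ T, g y) / T.card else 0

theorem spread_nonneg {g : (Fin d → ℤ) → ℝ} (hg : ∀ x, 0 ≤ g x) (T : Finset (Fin d → ℤ))
    (x : Fin d → ℤ) : 0 ≤ spread g T x := by
  unfold spread
  split_ifs
  · exact div_nonneg (Finset.sum_nonneg fun x _ => hg x) (by positivity)
  · exact le_rfl

/-- A set meeting the box has the whole box in its D-neighbourhood, and the spread mass on the box
equals the original mass there. -/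
theorem transports_spread_of_small {g : (Fin d → ℤ) → ℝ} (hg : ∀ x, 0 ≤ g x) {a b : Fin d → ℤ}
    {D : ℕ} (h : ∀ i, b i - a i ≤ D) :
    Transports D (fun x => if x ∈ box a b then g x else 0) (spread g (box a b)) := by
  intro A
  rw [← Finset.sum_filter]
  rcases (A.filter (· ∈ box a b)).eq_empty_or_nonempty with h0 | ⟨x, hx⟩
  · rw [h0, Finset.sum_empty]
    exact Finset.sum_nonneg fun x _ => spread_nonneg hg _ x
  · rw [Finset.mem_filter] at hx
    have hpos : (0 : ℝ) < (box a b).card := by exact_mod_cast Finset.card_pos.2 ⟨x, hx.2⟩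
    calc ∑ x ∈ A.filter (· ∈ box a b), g x ≤ ∑ x ∈ box a b, g x := by
          refine Finset.sum_le_sum_of_subset_of_nonneg ?_ fun x _ _ => hg x
          intro y hy
          exact (Finset.mem_filter.1 hy).2
      _ = ∑ x ∈ box a b, spread g (box a b) x := by
          rw [Finset.sum_congr rfl (g := fun _ => (∑ y ∈ box a b, g y) / (box a b).card)
            (fun y hy => show spread g (box a b) y = _ from if_pos hy), Finset.sum_const, nsmul_eq_mul]
          field_simp
      _ ≤ _ := by
          refine Finset.sum_le_sum_of_subset_of_nonneg ?_ fun x _ _ => spread_nonneg hg _ x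
          intro y hy
          refine mem_nbhd.2 ⟨x, hx.1, fun i => ?_⟩
          have h1 := mem_box.1 hx.2 i
          have h2 := mem_box.1 hy i
          have h3 := h i
          omega

/-- Two adjacent intervals carrying constant densities `α`, `β` and the same total mass as the
constant density `γ` on their union: the mass moves by at most the displacement of the
separating point, up to rounding. -/
theorem sum_two_densities_le {a m b : ℤ} (ham : a ≤ m) (hmb : m ≤ b) {α β γ : ℝ} (hα : 0 ≤ α)
    (hβ : 0 ≤ β) (hγ : 0 < γ) (hmass : α * (m - a) + β * (b - m) = γ * (b - a)) {e : ℕ}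
    (he : |α * (m - a) - γ * (m - a)| ≤ γ * (e - 1)) (A : Finset ℤ) :
    ∑ x ∈ A, (if a < x ∧ x ≤ m then α else if m < x ∧ x ≤ b then β else 0) ≤
      γ * (((A.biUnion fun x => Finset.Icc (x - e) (x + e)) ∩ Finset.Ioc a b).card : ℝ) := by
  -- The monotone rearrangement: the interval (φ(x - 1), φ(x)] has under density γ exactly the mass
  -- that x carries under α or β.
  let φ : ℤ → ℝ := fun x => a + α / γ * (min (x : ℝ) m - a) + β / γ * (max (x : ℝ) m - m)
  have hmono : Monotone φ := by
    intro x y hxy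
    have hxy' : (x : ℝ) ≤ y := by exact_mod_cast hxy
    simp only [φ]
    gcongr
  have hamR : (a : ℝ) ≤ m := by exact_mod_cast ham
  have hmbR : (m : ℝ) ≤ b := by exact_mod_cast hmb
  have hφa : φ a = a := by simp [φ, hamR]
  have hφb : φ b = b := by
    simp only [φ, min_eq_right hmbR, max_eq_left hmbR]
    field_simp
    linarith
  have hαe : |α / γ - 1| * (m - a) ≤ e - 1 := by
    have h0 : (α / γ - 1) * (m - a) = (α * (m - a) - γ * (m - a)) / γ := by
      field_simp
    have h1 : |α / γ - 1| * ((m : ℝ) - a) = |(α / γ - 1) * (m - a)| := by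
      rw [abs_mul, abs_of_nonneg (sub_nonneg.2 hamR)]
    rw [h1, h0, abs_div, abs_of_pos hγ, div_le_iff₀ hγ]
    linarith
  have hβe : |β / γ - 1| * (b - m) ≤ e - 1 := by
    have h0 : (β / γ - 1) * (b - m) = -((α * (m - a) - γ * (m - a)) / γ) := by
      field_simp
      linarith
    have h1 : |β / γ - 1| * ((b : ℝ) - m) = |(β / γ - 1) * (b - m)| := by
      rw [abs_mul, abs_of_nonneg (sub_nonneg.2 hmbR)]
    rw [h1, h0, abs_neg, abs_div, abs_of_pos hγ, div_le_iff₀ hγ]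
    linarith
  -- φ - id is piecewise linear and vanishes at a and b, so its extreme value is at m, where `he`
  -- controls it.
  have hdisp : ∀ x : ℤ, a ≤ x → x ≤ b → |φ x - x| ≤ e - 1 := by
    intro x hax hxb
    have hax' : (a : ℝ) ≤ x := by exact_mod_cast hax
    have hxb' : (x : ℝ) ≤ b := by exact_mod_cast hxb
    rcases le_total (x : ℝ) m with hx | hx
    · have h1 : φ x - x = (α / γ - 1) * (x - a) := by
        simp only [φ, min_eq_left hx, max_eq_right hx]; ring
      rw [h1, abs_mul, abs_of_nonneg (sub_nonneg.2 hax')]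
      refine le_trans ?_ hαe
      gcongr
    · have h1 : φ x - x = (φ b - b) - (β / γ - 1) * (b - x) := by
        simp only [φ, min_eq_right hx, max_eq_left hx, min_eq_right hmbR, max_eq_left hmbR]; ring
      rw [h1, hφb, sub_self, zero_sub, abs_neg, abs_mul, abs_of_nonneg (sub_nonneg.2 hxb')]
      refine le_trans ?_ hβe
      gcongr
  set A' := A ∩ Finset.Ioc a b with hA'
  set N := (A.biUnion fun x => Finset.Icc (x - e) (x + e)) ∩ Finset.Ioc a b with hN
  have hstep : ∀ x : ℤ, a < x → x ≤ b →
      (if a < x ∧ x ≤ m then α else if m < x ∧ x ≤ b then β else 0) = γ * (φ x - φ (x - 1)) := by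
    intro x hax hxb
    rcases le_or_gt x m with hx | hx
    · have hxR : (x : ℝ) ≤ m := by exact_mod_cast hx
      rw [if_pos ⟨hax, hx⟩]
      simp only [φ]
      push_cast
      rw [min_eq_left hxR, min_eq_left (by linarith), max_eq_right hxR, max_eq_right (by linarith)]
      field_simp
      ring
    · have hxR : (m : ℝ) ≤ x - 1 := by
        have : m ≤ x - 1 := by omega
        exact_mod_cast this
      rw [if_neg (by omega), if_pos ⟨hx, hxb⟩]
      simp only [φ]
      push_cast
      rw [min_eq_right (by linarith), min_eq_right hxR, max_eq_left (by linarith), max_eq_left hxR]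
      field_simp
      ring
  have hsum : ∑ x ∈ A, (if a < x ∧ x ≤ m then α else if m < x ∧ x ≤ b then β else 0) =
      γ * ∑ x ∈ A', (φ x - φ (x - 1)) := by
    rw [Finset.mul_sum, hA', ← Finset.filter_mem_eq_inter, Finset.sum_filter]
    refine Finset.sum_congr rfl fun x _ => ?_
    split_ifs with h1 h2 h3 h4 h5
    · rw [← hstep x (Finset.mem_Ioc.1 h2).1 (Finset.mem_Ioc.1 h2).2, if_pos h1]
    · exact absurd (Finset.mem_Ioc.2 ⟨h1.1, h1.2.trans hmb⟩) h2
    · rw [← hstep x (Finset.mem_Ioc.1 h4).1 (Finset.mem_Ioc.1 h4).2, if_neg h1, if_pos h3]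
    · exact absurd (Finset.mem_Ioc.2 ⟨ham.trans_lt h3.1, h3.2⟩) h4
    · rw [Finset.mem_Ioc] at h5; omega
    · rfl
  rw [hsum]
  refine mul_le_mul_of_nonneg_left ?_ hγ.le
  -- Compare Lebesgue measures: the disjoint image intervals are covered by the unit intervals (y -
  -- 1, y] with y ∈ N, of which there are |N|.
  have hdis : (↑A' : Set ℤ).PairwiseDisjoint fun x : ℤ => Set.Ioc (φ (x - 1)) (φ x) :=
    fun x _ y _ hxy => hmono.pairwise_disjoint_on_Ioc_pred hxy
  have hvol : volume (⋃ x ∈ A', Set.Ioc (φ (x - 1)) (φ x)) =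
      ENNReal.ofReal (∑ x ∈ A', (φ x - φ (x - 1))) := by
    rw [measure_biUnion_finset hdis fun _ _ => measurableSet_Ioc,
      ENNReal.ofReal_sum_of_nonneg fun x _ => sub_nonneg.2 (hmono (by omega))]
    simp
  have hvol' : volume (⋃ y ∈ N, Set.Ioc ((y : ℝ) - 1) y) ≤ ENNReal.ofReal N.card := by
    refine (measure_biUnion_finset_le _ _).trans ?_
    simp
  have hsub : (⋃ x ∈ A', Set.Ioc (φ (x - 1)) (φ x)) ⊆ ⋃ y ∈ N, Set.Ioc ((y : ℝ) - 1) y := by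
    intro s hs
    simp only [Set.mem_iUnion, Set.mem_Ioc, exists_prop] at hs ⊢
    obtain ⟨x, hx, hs1, hs2⟩ := hs
    rw [hA', Finset.mem_inter, Finset.mem_Ioc] at hx
    have h1 := abs_le.1 (hdisp x hx.2.1.le hx.2.2)
    have h2 := abs_le.1 (hdisp (x - 1) (by omega) (by omega))
    push_cast at h2
    have hl : φ a ≤ φ (x - 1) := hmono (by omega)
    have hr : φ x ≤ φ b := hmono hx.2.2
    rw [hφa] at hl
    rw [hφb] at hr
    have hc1 := Int.le_ceil s
    have hc2 := Int.ceil_lt_add_one s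
    refine ⟨⌈s⌉, ?_, by linarith, hc1⟩
    rw [hN, Finset.mem_inter, Finset.mem_biUnion]
    refine ⟨⟨x, hx.1, Finset.mem_Icc.2 ⟨?_, ?_⟩⟩, Finset.mem_Ioc.2 ⟨?_, ?_⟩⟩
    · have : ((x - e : ℤ) : ℝ) ≤ (⌈s⌉ : ℤ) := by push_cast; linarith
      exact_mod_cast this
    · have : ((⌈s⌉ : ℤ) : ℝ) < ((x + e : ℤ) : ℝ) + 1 := by push_cast; linarith
      exact Int.lt_add_one_iff.1 (by exact_mod_cast this)
    · have : ((a : ℤ) : ℝ) < (⌈s⌉ : ℤ) := by linarith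
      exact_mod_cast this
    · exact Int.ceil_le.2 (by linarith)
  have := (hvol ▸ measure_mono hsub).trans hvol'
  exact (ENNReal.ofReal_le_ofReal_iff (by positivity)).1 this

/-- Mass is moved only parallel to the i-th axis, so Hall's condition is checked line by line with
`sum_two_densities_le`. -/
theorem transports_two_densities {a b : Fin d → ℤ} {i : Fin d} {m : ℤ} (ham : a i ≤ m)
    (hmb : m ≤ b i) {α β γ : ℝ} (hα : 0 ≤ α) (hβ : 0 ≤ β) (hγ : 0 < γ)
    (hmass : α * (m - a i) + β * (b i - m) = γ * (b i - a i)) {e : ℕ}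
    (he : |α * (m - a i) - γ * (m - a i)| ≤ γ * (e - 1)) :
    Transports e
      (fun x => (if x ∈ box a (Function.update b i m) then α else 0) +
        if x ∈ box (Function.update a i m) b then β else 0)
      (fun x => if x ∈ box a b then γ else 0) := by
  intro A
  -- Erasing the i-th coordinate labels the line through x parallel to the i-th axis.
  let key : (Fin d → ℤ) → (Fin d → ℤ) := fun x => Function.update x i 0
  have hkey : ∀ {x y : Fin d → ℤ} {j : Fin d}, key x = key y → j ≠ i → x j = y j := by
    intro x y j h hj
    have := congrFun h j
    simpa [key, hj] using this
  rw [← Finset.sum_fiberwise_of_maps_to (t := A.image key) (g := key)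
    (fun x hx => Finset.mem_image_of_mem _ hx)]
  have hR : ∑ z ∈ A.image key, ∑ y ∈ (nbhd e A).filter (key · = z),
      (if y ∈ box a b then γ else 0) ≤ ∑ y ∈ nbhd e A, if y ∈ box a b then γ else 0 := by
    rw [Finset.sum_fiberwise_eq_sum_filter]
    refine Finset.sum_le_sum_of_subset_of_nonneg (Finset.filter_subset _ _) fun x _ _ => ?_
    split_ifs <;> [exact hγ.le; exact le_rfl]
  refine le_trans (Finset.sum_le_sum fun z _ => ?_) hR
  have hR0 : 0 ≤ ∑ y ∈ (nbhd e A).filter (key · = z), (if y ∈ box a b then γ else 0) :=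
    Finset.sum_nonneg fun x _ => by split_ifs <;> [exact hγ.le; exact le_rfl]
  by_cases hz : ∀ j, j ≠ i → a j < z j ∧ z j ≤ b j
  swap
  · refine le_trans (le_of_eq (Finset.sum_eq_zero fun x hx => ?_)) hR0
    obtain ⟨j, hj, hzj⟩ : ∃ j, j ≠ i ∧ ¬ (a j < z j ∧ z j ≤ b j) := by
      by_contra h
      refine hz fun j hj => ?_
      by_contra hc
      exact h ⟨j, hj, hc⟩
    have hxz : x j = z j := by
      rw [← (Finset.mem_filter.1 hx).2]; simp [key, hj]
    rw [if_neg, if_neg, add_zero]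
    · intro h
      have := mem_box.1 h j
      rw [Function.update_of_ne hj, hxz] at this
      exact hzj this
    · intro h
      have := mem_box.1 h j
      rw [Function.update_of_ne hj, hxz] at this
      exact hzj this
  have hx : ∀ x ∈ A.filter (key · = z), ∀ j, j ≠ i → a j < x j ∧ x j ≤ b j := by
    intro x hx j hj
    have hxz : x j = z j := by
      rw [← (Finset.mem_filter.1 hx).2]; simp [key, hj]
    rw [hxz]; exact hz j hj
  set A₁ : Finset ℤ := (A.filter (key · = z)).image (· i) with hA₁
  have hL : ∑ x ∈ A.filter (key · = z), ((if x ∈ box a (Function.update b i m) then α else 0) +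
        if x ∈ box (Function.update a i m) b then β else 0) =
      ∑ u ∈ A₁, (if a i < u ∧ u ≤ m then α else if m < u ∧ u ≤ b i then β else 0) := by
    rw [hA₁, Finset.sum_image]
    · refine Finset.sum_congr rfl fun x hxA => ?_
      have h1 : x ∈ box a (Function.update b i m) ↔ a i < x i ∧ x i ≤ m := by
        rw [mem_box]
        refine ⟨fun h => by simpa using h i, fun h j => ?_⟩
        by_cases hj : j = i
        · subst hj; simpa using h
        · simpa [hj] using hx x hxA j hj
      have h2 : x ∈ box (Function.update a i m) b ↔ m < x i ∧ x i ≤ b i := by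
        rw [mem_box]
        refine ⟨fun h => by simpa using h i, fun h j => ?_⟩
        by_cases hj : j = i
        · subst hj; simpa using h
        · simpa [hj] using hx x hxA j hj
      simp only [h1, h2]
      split_ifs with h3 h4
      · omega
      · simp
      · simp
      · simp
    · intro x hx y hy hxy
      rw [Finset.mem_coe, Finset.mem_filter] at hx hy
      funext j
      by_cases hj : j = i
      · subst hj; exact hxy
      · exact hkey (hx.2.trans hy.2.symm) hj
  rw [hL]
  refine (sum_two_densities_le ham hmb hα hβ hγ hmass he A₁).trans ?_
  rw [mul_comm, ← nsmul_eq_mul, ← Finset.sum_const]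
  set N := (A₁.biUnion fun x => Finset.Icc (x - e) (x + e)) ∩ Finset.Ioc (a i) (b i) with hN
  have hinj : Set.InjOn (fun u : ℤ => Function.update z i u) N := by
    intro u _ v _ huv
    have := congrFun huv i
    simpa using this
  rw [← Finset.sum_image (s := N) (g := fun u : ℤ => Function.update z i u)
    (f := fun _ => γ) hinj, ← Finset.sum_filter]
  refine Finset.sum_le_sum_of_subset_of_nonneg ?_ fun _ _ _ => hγ.le
  intro y hy
  obtain ⟨u, hu, rfl⟩ := Finset.mem_image.1 hy
  rw [hN, Finset.mem_inter, Finset.mem_biUnion, Finset.mem_Ioc] at hu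
  obtain ⟨⟨v, hv, huv⟩, hu⟩ := hu
  obtain ⟨x, hxA, rfl⟩ := Finset.mem_image.1 hv
  rw [Finset.mem_Icc] at huv
  have hxA' := Finset.mem_filter.1 hxA
  simp only [Finset.mem_filter]
  refine ⟨⟨mem_nbhd.2 ⟨x, hxA'.1, fun j => ?_⟩, ?_⟩, mem_box.2 fun j => ?_⟩
  · by_cases hj : j = i
    · subst hj; simpa using huv
    · rw [Function.update_of_ne hj, ← hxA'.2]
      simp [key, hj]
  · rw [← hxA'.2]; simp [key]
  · by_cases hj : j = i
    · subst hj; simpa using hu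
    · rw [Function.update_of_ne hj]; exact hz j hj

/-- Spreading the mass of `g` over a box, after it has been spread over the two halves. -/
theorem transports_spread_halves {g : (Fin d → ℤ) → ℝ} (hg : ∀ x, 0 ≤ g x) {a b : Fin d → ℤ}
    (hab : ∀ j, a j < b j) {i : Fin d} {m : ℤ} (ham : a i < m) (hmb : m < b i)
    (hpos : 0 < ∑ x ∈ box a b, g x) {e : ℕ}
    (he : |((b i : ℝ) - a i) * ∑ x ∈ box a (Function.update b i m), g x -
      ((m : ℝ) - a i) * ∑ x ∈ box a b, g x| ≤ (∑ x ∈ box a b, g x) * (e - 1)) :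
    Transports e (fun x => spread g (box a (Function.update b i m)) x +
      spread g (box (Function.update a i m) b) x) (spread g (box a b)) := by
  have hle : ∀ j, a j ≤ b j := fun j => (hab j).le
  have hV : (0 : ℝ) < (box a b).card := by
    rw [card_box hle]
    refine Finset.prod_pos fun j _ => sub_pos.2 ?_
    exact_mod_cast hab j
  have hamR : (a i : ℝ) < m := by exact_mod_cast ham
  have hmbR : (m : ℝ) < b i := by exact_mod_cast hmb
  have h0 := card_box_update_right hle ham.le
  have h1 := card_box_update_left hle hmb.le
  have hG : ∑ x ∈ box a (Function.update b i m), g x + ∑ x ∈ box (Function.update a i m) b, g x =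
      ∑ x ∈ box a b, g x := by
    rw [← Finset.sum_union (box_update_disjoint a b i m), box_update_union ham.le hmb.le]
  have hG0 : 0 ≤ ∑ x ∈ box a (Function.update b i m), g x := Finset.sum_nonneg fun x _ => hg x
  have hG1 : 0 ≤ ∑ x ∈ box (Function.update a i m) b, g x := Finset.sum_nonneg fun x _ => hg x
  unfold spread
  set V : ℝ := ((box a b).card : ℝ)
  set V₀ : ℝ := ((box a (Function.update b i m)).card : ℝ)
  set V₁ : ℝ := ((box (Function.update a i m) b).card : ℝ)
  set G := ∑ x ∈ box a b, g x
  set G₀ := ∑ x ∈ box a (Function.update b i m), g x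
  set G₁ := ∑ x ∈ box (Function.update a i m) b, g x
  -- Density times length along i is the mass per unit of cross-section, and the cross-section V/(b
  -- i - a i) is the same for both halves and for the whole box.
  have e0 : G₀ / V₀ * (m - a i) = G₀ * (b i - a i) / V := by
    have hL : (0 : ℝ) < b i - a i := by linarith
    have : V₀ = V * (m - a i) / (b i - a i) := by rw [← h0]; field_simp
    rw [this]
    have : (0 : ℝ) < m - a i := by linarith
    field_simp
  have e1 : G₁ / V₁ * (b i - m) = G₁ * (b i - a i) / V := by
    have hL : (0 : ℝ) < b i - a i := by linarith
    have : V₁ = V * (b i - m) / (b i - a i) := by rw [← h1]; field_simp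
    rw [this]
    have : (0 : ℝ) < b i - m := by linarith
    field_simp
  refine transports_two_densities ham.le hmb.le (by positivity) (by positivity) (by positivity) ?_ ?_
  · rw [e0, e1, ← hG]; ring
  · rw [e0, show G₀ * (b i - a i) / V - G / V * (m - a i) =
      ((b i - a i) * G₀ - (m - a i) * G) / V by ring, abs_div, abs_of_pos hV,
      div_mul_eq_mul_div]
    gcongr

/-- Multiscale transport: if every large fat box is split by `g` in nearly the right proportion
along its longest side, then `g` can be moved to the uniform distribution on the box. -/
theorem transports_spread_of_splits {g : (Fin d → ℤ) → ℝ} (hg : ∀ x, 0 ≤ g x) {n : ℤ} {H e : ℕ}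
    (hH : 1 ≤ H)
    (hsplit : ∀ (a b : Fin d → ℤ) (i : Fin d), (∀ j, 0 ≤ a j ∧ b j ≤ n) →
      (∀ j, (H : ℤ) ≤ b j - a j) → (∀ j k, b j - a j ≤ 2 * (b k - a k) + 1) →
      (∀ j, b j - a j ≤ b i - a i) → 2 * (H : ℤ) + 2 ≤ b i - a i →
      0 < ∑ x ∈ box a b, g x ∧
      |((b i : ℝ) - a i) * ∑ x ∈ box a (Function.update b i (a i + (b i - a i) / 2)), g x -
        (((a i + (b i - a i) / 2 : ℤ) : ℝ) - a i) * ∑ x ∈ box a b, g x| ≤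
          (∑ x ∈ box a b, g x) * (e - 1))
    (k : ℕ) (a b : Fin d → ℤ) (hn : ∀ j, 0 ≤ a j ∧ b j ≤ n) (hab : ∀ j, (H : ℤ) ≤ b j - a j)
    (hfat : ∀ j k, b j - a j ≤ 2 * (b k - a k) + 1)
    (hk : ((box a b).card : ℝ) ^ 2 ≤ 2 ^ k) :
    Transports (2 * H + 2 + k * e) (fun x => if x ∈ box a b then g x else 0)
      (spread g (box a b)) := by
  induction k generalizing a b with
  | zero =>
    refine (transports_spread_of_small hg (D := 1) fun i => ?_).mono (by omega) (spread_nonneg hg _)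
    have hpos : ∀ j, (1 : ℝ) ≤ (b j : ℝ) - a j := by
      intro j
      have : (1 : ℤ) ≤ b j - a j := by have := hab j; omega
      exact_mod_cast this
    have h1 : ((b i : ℝ) - a i) ≤ (box a b).card := by
      rw [card_box (fun j => by have := hab j; omega),
        ← Finset.mul_prod_erase _ _ (Finset.mem_univ i)]
      refine le_mul_of_one_le_right (by linarith [hpos i]) ?_
      exact Finset.one_le_prod fun j _ => hpos j
    have h2 : ((box a b).card : ℝ) ≤ 1 := by
      rw [pow_zero] at hk
      exact (sq_le_one_iff₀ (by positivity)).1 hk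
    have : ((b i - a i : ℤ) : ℝ) ≤ ((1 : ℕ) : ℤ) := by push_cast; linarith
    exact_mod_cast this
  | succ k ih =>
    by_cases hsmall : ∀ i, b i - a i ≤ ((2 * H + 2 : ℕ) : ℤ)
    · exact (transports_spread_of_small hg hsmall).mono (by omega) (spread_nonneg hg _)
    obtain ⟨i₀, hi₀⟩ := not_forall.1 hsmall
    obtain ⟨i, -, hi⟩ := Finset.exists_max_image Finset.univ (fun j => b j - a j)
      ⟨i₀, Finset.mem_univ _⟩
    have hi : ∀ j, b j - a j ≤ b i - a i := fun j => hi j (Finset.mem_univ _)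
    -- This length leaves both halves with side at least H, so the recursion stays among boxes on
    -- which `hsplit` may be used.
    have hbig : 2 * (H : ℤ) + 2 ≤ b i - a i := by have := hi i₀; push_cast at hi₀; omega
    obtain ⟨hpos, hdev⟩ := hsplit a b i hn hab hfat hi hbig
    set m := a i + (b i - a i) / 2 with hm
    have hle : ∀ j, a j ≤ b j := fun j => by have := hab j; omega
    have hmix := transports_spread_halves hg (fun j => by have := hab j; omega)
      (by omega : a i < m) (by omega : m < b i) hpos hdev
    have hL4 : (4 : ℝ) ≤ (b i : ℝ) - a i := by
      have : (4 : ℤ) ≤ b i - a i := by omega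
      exact_mod_cast this
    -- Halves of an odd side are unequal, so the volume need not halve. Its square does: s ≤ (L +
    -- 1)/2 and L ≥ 4 give (2s)² ≤ 2L². This is why `hk` bounds the squared volume.
    have hhalf : ∀ V s : ℝ, 0 ≤ V → 0 ≤ s → V * ((b i : ℝ) - a i) = (box a b).card * s →
        2 * s ≤ ((b i : ℝ) - a i) + 1 → V ^ 2 ≤ 2 ^ k := by
      intro V s hV hs hVs hs2
      set L := (b i : ℝ) - a i
      have h1 : (2 * s) ^ 2 ≤ 2 * L ^ 2 := by nlinarith
      have h2 : V ^ 2 * L ^ 2 = ((box a b).card : ℝ) ^ 2 * s ^ 2 := by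
        rw [← mul_pow, hVs, mul_pow]
      have h3 : V ^ 2 * L ^ 2 ≤ 2 ^ k * L ^ 2 := by
        rw [h2]
        calc ((box a b).card : ℝ) ^ 2 * s ^ 2 ≤ 2 ^ (k + 1) * s ^ 2 := by gcongr
          _ ≤ 2 ^ k * L ^ 2 := by
            rw [pow_succ]
            have : (0 : ℝ) < 2 ^ k := by positivity
            nlinarith
      exact le_of_mul_le_mul_right h3 (by positivity)
    have t0 := ih a (Function.update b i m)
      (fun j => by
        have := hn j; have := hn i; by_cases hj : j = i
        · subst hj; rw [Function.update_self]; omega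
        · rwa [Function.update_of_ne hj])
      (fun j => by
        have := hab j; by_cases hj : j = i
        · subst hj; rw [Function.update_self]; omega
        · rwa [Function.update_of_ne hj])
      -- Fatness survives because the longest side L satisfies L ≤ 2⌊L/2⌋ + 1; the `+ 1` in `hfat`
      -- accommodates odd L.
      (fun j l => by
        have h1 := hi j; have h2 := hfat i l; have h3 := hfat j l
        by_cases hj : j = i <;> by_cases hl : l = i
        · subst hj; subst hl; rw [Function.update_self]; omega
        · subst hj; rw [Function.update_self, Function.update_of_ne hl]; omega
        · subst hl; rw [Function.update_self, Function.update_of_ne hj]; omega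
        · rwa [Function.update_of_ne hl, Function.update_of_ne hj])
      (hhalf _ (m - a i) (by positivity)
        (by have : (0 : ℤ) ≤ m - a i := by omega
            exact_mod_cast this)
        (card_box_update_right hle (by omega))
        (by have : 2 * (m - a i) ≤ b i - a i + 1 := by omega
            exact_mod_cast this))
    have t1 := ih (Function.update a i m) b
      (fun j => by
        have := hn j; have := hn i; by_cases hj : j = i
        · subst hj; rw [Function.update_self]; omega
        · rwa [Function.update_of_ne hj])
      (fun j => by
        have := hab j; by_cases hj : j = i
        · subst hj; rw [Function.update_self]; omega
        · rwa [Function.update_of_ne hj])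
      (fun j l => by
        have h1 := hi j; have h2 := hfat i l; have h3 := hfat j l
        by_cases hj : j = i <;> by_cases hl : l = i
        · subst hj; subst hl; rw [Function.update_self]; omega
        · subst hj; rw [Function.update_self, Function.update_of_ne hl]; omega
        · subst hl; rw [Function.update_self, Function.update_of_ne hj]; omega
        · rwa [Function.update_of_ne hl, Function.update_of_ne hj])
      (hhalf _ (b i - m) (by positivity)
        (by have : (0 : ℤ) ≤ b i - m := by omega
            exact_mod_cast this)
        (card_box_update_left hle (by omega))
        (by have : 2 * (b i - m) ≤ b i - a i + 1 := by omega
            exact_mod_cast this))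
    have ht := (t0.add t1).trans hmix (spread_nonneg hg _)
    have hfun : (fun x => (if x ∈ box a (Function.update b i m) then g x else 0) +
        if x ∈ box (Function.update a i m) b then g x else 0) =
        fun x => if x ∈ box a b then g x else 0 := by
      funext x
      rw [← box_update_union (a := a) (b := b) (i := i) (m := m) (by omega) (by omega)]
      have hd : x ∈ box a (Function.update b i m) → x ∉ box (Function.update a i m) b :=
        fun h => Finset.disjoint_left.1 (box_update_disjoint a b i m) h
      by_cases h0 : x ∈ box a (Function.update b i m)
      · simp [h0, hd h0]
      · simp [h0]
    rw [hfun] at ht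
    exact ht.mono (le_of_eq (by ring)) (spread_nonneg hg _)

/-! ### Cells of the large grid and their sizes -/

/-- The index in `{1, …, n}` of the cell of length `N / n` containing `x ∈ {1, …, N}`,
that is `⌈n x / N⌉`. -/
def cell (N n : ℕ) (x : ℤ) : ℤ := (n * x + N - 1) / N

theorem cell_le_iff {N n : ℕ} (hN : 0 < N) {x b : ℤ} : cell N n x ≤ b ↔ (n : ℤ) * x ≤ b * N := by
  have hN' : (0 : ℤ) < N := by exact_mod_cast hN
  rw [cell, ← Int.lt_add_one_iff, Int.ediv_lt_iff_lt_mul hN', add_mul]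
  omega

theorem lt_cell_iff {N n : ℕ} (hN : 0 < N) {x a : ℤ} : a < cell N n x ↔ a * N < (n : ℤ) * x := by
  rw [← not_le, cell_le_iff hN, not_le]

/-- Scaling by n/N ≤ 1 does not expand, and the ceiling commutes with the integer shift |x - y|, so
rounding costs nothing. -/
theorem cell_le_cell_add {N n : ℕ} (hn : 0 < n) (hnN : n ≤ N) (x y : ℤ) :
    cell N n x ≤ cell N n y + |x - y| := by
  have hN : 0 < N := hn.trans_le hnN
  rw [cell_le_iff hN, add_mul]
  have h1 : (n : ℤ) * y ≤ cell N n y * N := (cell_le_iff hN).1 le_rfl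
  have h2 : (n : ℤ) * (x - y) ≤ |x - y| * N := by
    have h3 := le_abs_self (x - y)
    have h4 : (n : ℤ) ≤ N := by exact_mod_cast hnN
    have h5 := abs_nonneg (x - y)
    calc (n : ℤ) * (x - y) ≤ n * |x - y| := by gcongr
      _ ≤ N * |x - y| := by gcongr
      _ = _ := mul_comm _ _
  linarith

theorem cell_mem {N n : ℕ} (hn : 0 < n) (hnN : n ≤ N) {x : ℤ} (h1 : 1 ≤ x) (h2 : x ≤ N) :
    0 < cell N n x ∧ cell N n x ≤ n := by
  have hN : 0 < N := hn.trans_le hnN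
  rw [lt_cell_iff hN, cell_le_iff hN]
  have hn' : (0 : ℤ) < n := by exact_mod_cast hn
  constructor
  · rw [zero_mul]; positivity
  · gcongr

/-- The normalised number of points of `{1, …, N}` whose cell lies in `(a, b]`. -/
noncomputable def width (N n : ℕ) (a b : ℤ) : ℝ :=
  (n : ℝ) / N * ((Finset.Icc 1 (N : ℤ)).filter fun x => a < cell N n x ∧ cell N n x ≤ b).card

/-- The cells in (a, b] pull back to the lattice interval (⌊aN/n⌋, ⌊bN/n⌋]. Widths are thus exactly
additive, and differ from b - a only by the rounding of the endpoints. -/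
theorem width_eq {N n : ℕ} (hn : 0 < n) (hnN : n ≤ N) {a b : ℤ} (ha : 0 ≤ a) (hab : a ≤ b)
    (hb : b ≤ n) :
    width N n a b = (n : ℝ) / N * (((b * N / n : ℤ) : ℝ) - ((a * N / n : ℤ) : ℝ)) := by
  have hN : 0 < N := hn.trans_le hnN
  have hn' : (0 : ℤ) < n := by exact_mod_cast hn
  have hN' : (0 : ℤ) < N := by exact_mod_cast hN
  have hset : ((Finset.Icc 1 (N : ℤ)).filter fun x => a < cell N n x ∧ cell N n x ≤ b) =
      Finset.Ioc (a * N / n) (b * N / n) := by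
    ext x
    rw [Finset.mem_filter, Finset.mem_Icc, Finset.mem_Ioc, lt_cell_iff hN, cell_le_iff hN,
      Int.ediv_lt_iff_lt_mul hn', Int.le_ediv_iff_mul_le hn', mul_comm x]
    refine ⟨fun h => h.2, fun h => ⟨⟨?_, ?_⟩, h⟩⟩
    · have : 0 < (n : ℤ) * x := lt_of_le_of_lt (by positivity) h.1
      exact pos_of_mul_pos_right this hn'.le
    · have : (n : ℤ) * x ≤ n * N := h.2.trans (by gcongr)
      exact le_of_mul_le_mul_left this hn'
  have hle : a * N / n ≤ b * N / n := Int.ediv_le_ediv hn' (by gcongr)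
  rw [width, hset, Int.card_Ioc]
  congr 1
  have : (((b * N / n - a * N / n).toNat : ℤ) : ℝ) = ((b * N / n - a * N / n : ℤ) : ℝ) := by
    rw [Int.toNat_of_nonneg (by linarith)]
  push_cast at this ⊢
  exact this

theorem width_add {N n : ℕ} (hn : 0 < n) (hnN : n ≤ N) {a m b : ℤ} (ha : 0 ≤ a) (ham : a ≤ m)
    (hmb : m ≤ b) (hb : b ≤ n) : width N n a m + width N n m b = width N n a b := by
  rw [width_eq hn hnN ha ham (hmb.trans hb), width_eq hn hnN (ha.trans ham) hmb hb,
    width_eq hn hnN ha (ham.trans hmb) hb]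
  ring

theorem abs_width_sub_le {N n : ℕ} (hn : 0 < n) (hnN : n ≤ N) {a b : ℤ} (ha : 0 ≤ a) (hab : a ≤ b)
    (hb : b ≤ n) : |width N n a b - (b - a)| ≤ 1 := by
  have hN : 0 < N := hn.trans_le hnN
  have hnR : (0 : ℝ) < n := by exact_mod_cast hn
  have hNR : (0 : ℝ) < N := by exact_mod_cast hN
  have hn' : (0 : ℤ) < n := by exact_mod_cast hn
  have key : ∀ c : ℤ, (n : ℝ) / N * ((c * N / n : ℤ) : ℝ) ≤ c ∧
      c - 1 ≤ (n : ℝ) / N * ((c * N / n : ℤ) : ℝ) := by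
    intro c
    have h1 : c * N / n * n ≤ c * N := Int.ediv_mul_le _ hn'.ne'
    have h2 : c * N < (c * N / n + 1) * n := Int.lt_ediv_add_one_mul_self _ hn'
    have h1' : ((c * N / n : ℤ) : ℝ) * n ≤ c * N := by exact_mod_cast h1
    have h2' : (c : ℝ) * N < (((c * N / n : ℤ) : ℝ) + 1) * n := by exact_mod_cast h2
    have h3 : (n : ℝ) ≤ N := by exact_mod_cast hnN
    constructor
    · rw [div_mul_eq_mul_div, div_le_iff₀ hNR]; linarith
    · rw [div_mul_eq_mul_div, le_div_iff₀ hNR]; linarith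
  rw [width_eq hn hnN ha hab hb, mul_sub, abs_le]
  have hA := key a
  have hB := key b
  constructor <;> linarith [hA.1, hA.2, hB.1, hB.2]

/-- The points of `{1, …, N}^d` whose cell lies in the box `∏ (a i, b i]`. -/
noncomputable def cellBox (N n : ℕ) (a b : Fin d → ℤ) : Finset (Fin d → ℤ) :=
  (grid d N).filter fun x => (fun i => cell N n (x i)) ∈ box a b

/-- The left side is the mean number of points of a random n^d-subset in the box of cells; the
product form lets one side be split while the cross-section is kept. -/
theorem card_cellBox (N n : ℕ) (a b : Fin d → ℤ) :
    ((n ^ d : ℕ) : ℝ) / (grid d N).card * (cellBox N n a b).card =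
      ∏ j, width N n (a j) (b j) := by
  have h : cellBox N n a b = Fintype.piFinset fun j =>
      (Finset.Icc 1 (N : ℤ)).filter fun x => a j < cell N n x ∧ cell N n x ≤ b j := by
    ext x
    simp only [cellBox, grid, mem_box, Finset.mem_filter, Fintype.mem_piFinset]
    exact forall_and.symm
  simp only [width]
  rw [h, Fintype.card_piFinset, Finset.prod_mul_distrib, card_grid]
  simp

/-! ### Balanced sets and the bisection of boxes -/

/-- All sufficiently large boxes of cells contain nearly the expected number of points of `S`. -/
def IsBalanced (N n H : ℕ) (κ : ℝ) (S : Finset (Fin d → ℤ)) : Prop :=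
  ∀ a b : Fin d → ℤ, (∀ j, 0 ≤ a j ∧ b j ≤ n) → (∀ j, (H : ℤ) ≤ b j - a j) →
    |((S ∩ cellBox N n a b).card : ℝ) - ∏ j, width N n (a j) (b j)| ≤
      2 * √(κ * ∏ j, width N n (a j) (b j))

theorem half_le_width {N n : ℕ} (hn : 0 < n) (hnN : n ≤ N) {a b : ℤ} (ha : 0 ≤ a)
    (hab : 2 ≤ b - a) (hb : b ≤ n) : ((b : ℝ) - a) / 2 ≤ width N n a b := by
  have h1 := (abs_le.1 (abs_width_sub_le hn hnN ha (by omega) hb)).1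
  have h2 : (2 : ℝ) ≤ b - a := by exact_mod_cast hab
  linarith

theorem prod_width_ge {N n H : ℕ} (hn : 0 < n) (hnN : n ≤ N) (hH : 2 ≤ H) {h : ℝ}
    (h0 : 0 ≤ h) (hhH : h ≤ H) {a b : Fin d → ℤ} (hab : ∀ j, 0 ≤ a j ∧ b j ≤ n)
    (hside : ∀ j, (H : ℤ) ≤ b j - a j) : h ^ d / 2 ^ d ≤ ∏ j, width N n (a j) (b j) := by
  have : h ^ d / 2 ^ d = ∏ _j : Fin d, h / 2 := by simp
  rw [this]
  refine Finset.prod_le_prod (fun j _ => by positivity) fun j _ => ?_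
  have h1 := half_le_width hn hnN (hab j).1 (by have := hside j; omega) (hab j).2
  have h2 : ((H : ℤ) : ℝ) ≤ ((b j - a j : ℤ) : ℝ) := by exact_mod_cast hside j
  push_cast at h2
  linarith

/-- Each width is at least (h/2) · (side/h) with side/h ≥ 1. Keep this ratio only for i and for one
other direction l, which exists as d ≥ 2; fatness gives side l at least a third of side i. The
square of the length is what later cancels L in the displacement. -/
theorem prod_width_ge_of_fat {N n H : ℕ} (hd : 2 ≤ d) (hn : 0 < n) (hnN : n ≤ N) (hH : 2 ≤ H)
    {h : ℝ} (h0 : 0 < h) (hhH : h ≤ H) {a b : Fin d → ℤ} (hab : ∀ j, 0 ≤ a j ∧ b j ≤ n)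
    (hside : ∀ j, (H : ℤ) ≤ b j - a j) (hfat : ∀ j k, b j - a j ≤ 2 * (b k - a k) + 1)
    (i : Fin d) :
    h ^ d / 2 ^ d * (((b i : ℝ) - a i) ^ 2 / (3 * h ^ 2)) ≤ ∏ j, width N n (a j) (b j) := by
  have : Nontrivial (Fin d) := Fin.nontrivial_iff_two_le.2 hd
  obtain ⟨l, hl⟩ := exists_ne i
  have hlow : ∏ j, (h / 2 * (((b j : ℝ) - a j) / h)) ≤ ∏ j, width N n (a j) (b j) := by
    refine Finset.prod_le_prod (fun j _ => ?_) fun j _ => ?_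
    · have : (0 : ℝ) ≤ ((b j - a j : ℤ) : ℝ) := by
        have := hside j
        exact_mod_cast (by omega : (0 : ℤ) ≤ b j - a j)
      push_cast at this
      positivity
    · have h1 := half_le_width hn hnN (hab j).1 (by have := hside j; omega) (hab j).2
      refine le_trans (le_of_eq ?_) h1
      field_simp
  refine le_trans ?_ hlow
  rw [Finset.prod_mul_distrib, Finset.prod_const, Finset.card_univ, Fintype.card_fin, div_pow]
  refine mul_le_mul_of_nonneg_left ?_ (by positivity)
  have hone : ∀ j, 1 ≤ ((b j : ℝ) - a j) / h := by
    intro j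
    have h2 : ((H : ℤ) : ℝ) ≤ ((b j - a j : ℤ) : ℝ) := by exact_mod_cast hside j
    push_cast at h2
    rw [le_div_iff₀ h0]
    linarith
  rw [← Finset.mul_prod_erase _ _ (Finset.mem_univ i), ← Finset.mul_prod_erase _ _
    (Finset.mem_erase.2 ⟨hl, Finset.mem_univ l⟩), ← mul_assoc]
  have hi := hone i
  have hl1 := hone l
  refine le_trans ?_ (le_mul_of_one_le_right (by positivity)
    (Finset.one_le_prod fun j _ => hone j))
  have hfl : ((b i : ℝ) - a i) / 3 ≤ b l - a l := by
    have : b i - a i ≤ 3 * (b l - a l) := by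
      have := hfat i l; have := hside l; omega
    have : (b i : ℝ) - a i ≤ 3 * (b l - a l) := by exact_mod_cast this
    linarith
  have hpos : 0 ≤ (b i : ℝ) - a i := by
    have := hside i
    exact_mod_cast (by omega : (0 : ℤ) ≤ b i - a i)
  calc ((b i : ℝ) - a i) ^ 2 / (3 * h ^ 2)
      = (b i - a i) / h * (((b i : ℝ) - a i) / 3 / h) := by field_simp
    _ ≤ _ := by gcongr

theorem abs_mul_sub_mul_le {p r x y c : ℝ} (hr : 0 ≤ r) (hp : 0 ≤ p) (hx : |x| ≤ c)
    (hy : |y| ≤ c) : |r * x - p * y| ≤ (r + p) * c := by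
  refine (abs_sub _ _).trans ?_
  rw [abs_mul, abs_mul, abs_of_nonneg hr, abs_of_nonneg hp, add_mul]
  gcongr

/-- In a balanced set, a large fat box is split along its longest side in nearly the right
proportion. -/
theorem IsBalanced.split {N n H : ℕ} {Λ κ h : ℝ} {S : Finset (Fin d → ℤ)}
    (hS : IsBalanced N n H (κ * Λ) S) (hd : 2 ≤ d) (hn : 0 < n) (hnN : n ≤ N) (hH : 2 ≤ H)
    (hΛ : 0 < Λ) (hκ : 0 < κ) (h0 : 0 < h) (hhH : h ≤ H) (hhd : Λ ^ 3 ≤ h ^ d)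
    (hbig : 16 * κ * 2 ^ d ≤ Λ ^ 2) {a b : Fin d → ℤ} {i : Fin d}
    (hab : ∀ j, 0 ≤ a j ∧ b j ≤ n) (hside : ∀ j, (H : ℤ) ≤ b j - a j)
    (hfat : ∀ j k, b j - a j ≤ 2 * (b k - a k) + 1)
    {m : ℤ} (hm : (H : ℤ) ≤ m - a i) (hm' : (H : ℤ) ≤ b i - m) :
    0 < ((S ∩ cellBox N n a b).card : ℝ) ∧
    |((b i : ℝ) - a i) * ((S ∩ cellBox N n a (Function.update b i m)).card : ℝ) -
        ((m : ℝ) - a i) * ((S ∩ cellBox N n a b).card : ℝ)| ≤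
      ((S ∩ cellBox N n a b).card : ℝ) * (4 + 2 * (√(12 * κ * 2 ^ d) * h / Λ)) := by
  have hab0 : ∀ j, 0 ≤ a j ∧ Function.update b i m j ≤ n := by
    intro j
    have := hab j
    by_cases hj : j = i
    · subst hj; rw [Function.update_self]; omega
    · rwa [Function.update_of_ne hj]
  have hab1 : ∀ j, 0 ≤ Function.update a i m j ∧ b j ≤ n := by
    intro j
    have := hab j
    by_cases hj : j = i
    · subst hj; rw [Function.update_self]; omega
    · rwa [Function.update_of_ne hj]
  have hside0 : ∀ j, (H : ℤ) ≤ Function.update b i m j - a j := by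
    intro j
    have := hside j
    by_cases hj : j = i
    · subst hj; rwa [Function.update_self]
    · rwa [Function.update_of_ne hj]
  have hside1 : ∀ j, (H : ℤ) ≤ b j - Function.update a i m j := by
    intro j
    have := hside j
    by_cases hj : j = i
    · subst hj; rwa [Function.update_self]
    · rwa [Function.update_of_ne hj]
  have hG := hS a b hab hside
  have hG0 := hS _ _ hab0 hside0
  have hG1 := hS _ _ hab1 hside1
  have hsum : ((S ∩ cellBox N n a (Function.update b i m)).card : ℝ) +
      (S ∩ cellBox N n (Function.update a i m) b).card = (S ∩ cellBox N n a b).card := by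
    rw [← Nat.cast_add, ← Finset.card_union_of_disjoint]
    · congr 2
      rw [← Finset.inter_union_distrib_left, cellBox, cellBox, ← Finset.filter_or]
      congr 1
      refine Finset.filter_congr fun x _ => ?_
      rw [← Finset.mem_union, box_update_union (by omega) (by omega)]
    · refine Finset.disjoint_left.2 fun x hx hy => ?_
      exact Finset.disjoint_left.1 (box_update_disjoint a b i m)
        (Finset.mem_filter.1 (Finset.mem_inter.1 hx).2).2
        (Finset.mem_filter.1 (Finset.mem_inter.1 hy).2).2
  have hM1 := prod_width_ge hn hnN hH h0.le hhH hab hside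
  have hM2 := prod_width_ge_of_fat hd hn hnN hH h0 hhH hab hside hfat i
  have hwpos : ∀ j, 0 ≤ width N n (a j) (b j) := fun j => by unfold width; positivity
  have hY : width N n (a i) m + width N n m (b i) = width N n (a i) (b i) :=
    width_add hn hnN (hab i).1 (by omega) (by omega) (hab i).2
  have hY0 := abs_width_sub_le hn hnN (hab i).1 (by omega : a i ≤ m) (by have := hab i; omega)
  have hY1 := abs_width_sub_le hn hnN (by have := hab i; omega) (by omega : m ≤ b i) (hab i).2
  have hYi := half_le_width hn hnN (hab i).1 (by omega) (hab i).2
  have hw0 : 0 ≤ width N n (a i) m := by unfold width; positivity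
  have hw1 : 0 ≤ width N n m (b i) := by unfold width; positivity
  have hp : (0 : ℝ) ≤ m - a i := by exact_mod_cast (by omega : (0 : ℤ) ≤ m - a i)
  have hr : (0 : ℝ) ≤ b i - m := by exact_mod_cast (by omega : (0 : ℤ) ≤ b i - m)
  have hB : 0 ≤ ∏ j ∈ Finset.univ.erase i, width N n (a j) (b j) :=
    Finset.prod_nonneg fun j _ => hwpos j
  have f : ∏ j, width N n (a j) (b j) =
      width N n (a i) (b i) * ∏ j ∈ Finset.univ.erase i, width N n (a j) (b j) :=
    (Finset.mul_prod_erase _ _ (Finset.mem_univ i)).symm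
  have f0 : ∏ j, width N n (a j) (Function.update b i m j) =
      width N n (a i) m * ∏ j ∈ Finset.univ.erase i, width N n (a j) (b j) := by
    rw [← Finset.mul_prod_erase _ _ (Finset.mem_univ i), Function.update_self]
    congr 1
    exact Finset.prod_congr rfl fun j hj => by rw [Function.update_of_ne (Finset.ne_of_mem_erase hj)]
  have f1 : ∏ j, width N n (Function.update a i m j) (b j) =
      width N n m (b i) * ∏ j ∈ Finset.univ.erase i, width N n (a j) (b j) := by
    rw [← Finset.mul_prod_erase _ _ (Finset.mem_univ i), Function.update_self]
    congr 1
    exact Finset.prod_congr rfl fun j hj => by rw [Function.update_of_ne (Finset.ne_of_mem_erase hj)]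
  rw [f0] at hG0
  rw [f1] at hG1
  rw [f] at hG hM1 hM2
  generalize ∏ j ∈ Finset.univ.erase i, width N n (a j) (b j) = B at *
  generalize width N n (a i) (b i) = Y at *
  generalize width N n (a i) m = Y₀ at *
  generalize width N n m (b i) = Y₁ at *
  generalize ((S ∩ cellBox N n a (Function.update b i m)).card : ℝ) = G₀ at *
  generalize ((S ∩ cellBox N n (Function.update a i m) b).card : ℝ) = G₁ at *
  generalize ((S ∩ cellBox N n a b).card : ℝ) = G at *
  set L := (b i : ℝ) - a i with hL
  have hLpos : 0 ≤ L := by linarith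
  set M := Y * B with hM
  have h2d : (0 : ℝ) < 2 ^ d := by positivity
  have hM16 : 16 * (κ * Λ) ≤ M := by
    refine le_trans ?_ hM1
    rw [le_div_iff₀ h2d]
    refine le_trans ?_ hhd
    calc 16 * (κ * Λ) * 2 ^ d = (16 * κ * 2 ^ d) * Λ := by ring
      _ ≤ Λ ^ 2 * Λ := by gcongr
      _ = Λ ^ 3 := by ring
  have hMpos : 0 < M := lt_of_lt_of_le (by positivity) hM16
  have hGM : M / 2 ≤ G := by
    have h1 : √(κ * Λ * M) ≤ M / 4 := by
      refine Real.sqrt_le_iff.2 ⟨by positivity, ?_⟩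
      nlinarith
    have := (abs_le.1 hG).1
    linarith
  have hE0 : √(κ * Λ * (Y₀ * B)) ≤ √(κ * Λ * M) := by
    refine Real.sqrt_le_sqrt ?_
    rw [hM, ← hY]
    gcongr
    linarith
  have hE1 : √(κ * Λ * (Y₁ * B)) ≤ √(κ * Λ * M) := by
    refine Real.sqrt_le_sqrt ?_
    rw [hM, ← hY]
    gcongr
    linarith
  set E := √(κ * Λ * M) with hE
  set W := √(12 * κ * 2 ^ d) * h / Λ with hW
  -- After squaring, the lower bound on M contributes L²/(3h²), which cancels L; Λ³ ≤ h^d turns the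
  -- remainder into a multiple of h/Λ.
  have hLE : L * (2 * E) ≤ M * W := by
    have hsq : (L * (2 * E)) ^ 2 ≤ (M * W) ^ 2 := by
      have e1 : (L * (2 * E)) ^ 2 = 4 * κ * Λ * L ^ 2 * M := by
        rw [mul_pow, mul_pow, hE, Real.sq_sqrt (by positivity)]; ring
      have e2 : (M * W) ^ 2 = (12 * κ * 2 ^ d * h ^ 2 / Λ ^ 2 * M) * M := by
        rw [mul_pow M W, hW, div_pow, mul_pow (√_) h, Real.sq_sqrt (by positivity)]; ring
      rw [e1, e2]
      refine mul_le_mul_of_nonneg_right ?_ hMpos.le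
      calc 4 * κ * Λ * L ^ 2
          = 12 * κ * 2 ^ d * h ^ 2 / Λ ^ 2 * (Λ ^ 3 / 2 ^ d * (L ^ 2 / (3 * h ^ 2))) := by
            field_simp; ring
        _ ≤ 12 * κ * 2 ^ d * h ^ 2 / Λ ^ 2 * (h ^ d / 2 ^ d * (L ^ 2 / (3 * h ^ 2))) := by gcongr
        _ ≤ _ := by gcongr
    exact le_of_sq_le_sq hsq (by positivity)
  refine ⟨by linarith, ?_⟩
  -- The imbalance is a sampling error of the two halves plus the rounding error of the widths times
  -- the cross-section B. The former is at most 2E · L ≤ 2GW, the latter at most BL ≤ 4G.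
  have hdec : L * G₀ - (m - a i) * G = (b i - m) * (G₀ - Y₀ * B) - (m - a i) * (G₁ - Y₁ * B) +
      B * ((b i - m) * (Y₀ - (m - a i)) - (m - a i) * (Y₁ - (b i - m))) := by
    rw [← hsum, hL]; ring
  have hBL : B * L ≤ 4 * G := by
    have : B * (L / 2) ≤ B * Y := by gcongr
    linarith
  have hG0' := hG0.trans (mul_le_mul_of_nonneg_left hE0 (by norm_num))
  have hG1' := hG1.trans (mul_le_mul_of_nonneg_left hE1 (by norm_num))
  have hWpos : 0 ≤ W := by positivity
  have hMW : M * W ≤ 2 * G * W := by gcongr; linarith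
  have hX : |(b i - m) * (Y₀ - (m - a i)) - (m - a i) * (Y₁ - (b i - m))| ≤ L := by
    refine (abs_mul_sub_mul_le hr hp hY0 hY1).trans (le_of_eq ?_)
    rw [hL]; ring
  have hX' : |B * ((b i - m) * (Y₀ - (m - a i)) - (m - a i) * (Y₁ - (b i - m)))| ≤ B * L := by
    rw [abs_mul, abs_of_nonneg hB]
    gcongr
  have hX2 : |(b i - m) * (G₀ - Y₀ * B) - (m - a i) * (G₁ - Y₁ * B)| ≤ L * (2 * E) := by
    refine (abs_mul_sub_mul_le hr hp hG0' hG1').trans (le_of_eq ?_)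
    rw [hL]; ring
  rw [hdec]
  refine (abs_add_le _ _).trans ?_
  linarith

/-! ### From transport to Lipschitz surjections -/

/-- The number of points of `S` in the cell with index `y`. -/
noncomputable def cellCount (N n : ℕ) (S : Finset (Fin d → ℤ)) (y : Fin d → ℤ) : ℝ :=
  (S.filter fun x => (fun i => cell N n (x i)) = y).card

theorem sum_cellCount_box {N n : ℕ} {S : Finset (Fin d → ℤ)} (hS : S ⊆ grid d N)
    (a b : Fin d → ℤ) :
    ∑ y ∈ box a b, cellCount N n S y = ((S ∩ cellBox N n a b).card : ℝ) := by
  have h1 : S ∩ cellBox N n a b = S.filter fun x => (fun i => cell N n (x i)) ∈ box a b := by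
    ext x
    rw [cellBox, Finset.mem_inter, Finset.mem_filter, Finset.mem_filter]
    exact ⟨fun h => ⟨h.1, h.2.2⟩, fun h => ⟨h.1, hS h.1, h.2⟩⟩
  rw [h1, Finset.card_eq_sum_card_fiberwise
    (s := S.filter fun x => (fun i => cell N n (x i)) ∈ box a b)
    (f := fun (x : Fin d → ℤ) (i : Fin d) => cell N n (x i)) (t := box a b)
    (fun x hx => (Finset.mem_filter.1 hx).2), Nat.cast_sum]
  refine Finset.sum_congr rfl fun y hy => ?_
  rw [cellCount, Finset.filter_filter]
  congr 2
  refine Finset.filter_congr fun x _ => ?_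
  exact ⟨fun h => ⟨h ▸ hy, h⟩, fun h => h.2⟩

/-- Hall's marriage theorem, where x may be matched to any grid point within D of its cell. The
resulting injection is onto since both sides have n^d elements. -/
theorem exists_matching {N n D : ℕ} {S : Finset (Fin d → ℤ)} (hcard : S.card = n ^ d)
    (hT : Transports D (cellCount N n S) (fun x => if x ∈ grid d n then 1 else 0)) :
    ∃ f : S → grid d n, Function.Surjective f ∧
      ∀ (x : S) (i : Fin d), |(f x).1 i - cell N n (x.1 i)| ≤ D := by
  classical
  let π : (Fin d → ℤ) → (Fin d → ℤ) := fun x i => cell N n (x i)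
  have hall : ∀ s : Finset S,
      s.card ≤ (s.biUnion fun x => (nbhd D {π x.1}).filter (· ∈ grid d n)).card := by
    intro s
    have h1 := hT (s.image fun x => π x.1)
    rw [← Finset.sum_filter, Finset.sum_const, nsmul_eq_mul, mul_one] at h1
    have h2 : (s.card : ℝ) ≤ ∑ y ∈ s.image fun x => π x.1, cellCount N n S y := by
      rw [Finset.card_eq_sum_card_image (fun x : S => π x.1) s, Nat.cast_sum]
      refine Finset.sum_le_sum fun y _ => ?_
      rw [cellCount, Nat.cast_le]
      refine Finset.card_le_card_of_injOn (fun x => x.1) ?_ (Subtype.val_injective.injOn)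
      intro x hx
      have hx := (Finset.mem_filter.1 hx).2
      exact Finset.mem_filter.2 ⟨x.2, hx⟩
    have h3 := h2.trans h1
    refine (Nat.cast_le.1 h3).trans (Finset.card_le_card ?_)
    intro y hy
    obtain ⟨hy1, hy2⟩ := Finset.mem_filter.1 hy
    obtain ⟨z, hz, hzy⟩ := mem_nbhd.1 hy1
    obtain ⟨x, hx, rfl⟩ := Finset.mem_image.1 hz
    exact Finset.mem_biUnion.2 ⟨x, hx, Finset.mem_filter.2
      ⟨mem_nbhd.2 ⟨_, Finset.mem_singleton_self _, hzy⟩, hy2⟩⟩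
  obtain ⟨f, hinj, hf⟩ := (Finset.all_card_le_biUnion_card_iff_exists_injective _).1 hall
  refine ⟨fun x => ⟨f x, (Finset.mem_filter.1 (hf x)).2⟩, ?_, fun x i => ?_⟩
  · refine ((Fintype.bijective_iff_injective_and_card _).2 ⟨fun x y h => hinj ?_, ?_⟩).2
    · exact congrArg Subtype.val h
    · rw [Fintype.card_coe, Fintype.card_coe, hcard, card_grid]
  · obtain ⟨z, hz, h⟩ := mem_nbhd.1 (Finset.mem_filter.1 (hf x)).1
    rw [Finset.mem_singleton] at hz
    subst hz
    have := h i
    rw [abs_le]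
    constructor <;> simp only [π] at this <;> linarith

theorem dist_toEuclidean_le {x y : Fin d → ℤ} {M : ℝ} (h : ∀ i, |((x i - y i : ℤ) : ℝ)| ≤ M) :
    dist (toEuclidean x) (toEuclidean y) ≤ d * M := by
  rcases d.eq_zero_or_pos with rfl | hd
  · simp [EuclideanSpace.dist_eq]
  have hM : 0 ≤ M := (abs_nonneg _).trans (h ⟨0, hd⟩)
  rw [EuclideanSpace.dist_eq]
  refine Real.sqrt_le_iff.2 ⟨by positivity, ?_⟩
  calc ∑ i, dist (toEuclidean x i) (toEuclidean y i) ^ 2 ≤ ∑ _i : Fin d, M ^ 2 := by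
        refine Finset.sum_le_sum fun i _ => ?_
        have := h i
        push_cast at this
        rw [Real.dist_eq]
        exact pow_le_pow_left₀ (abs_nonneg _) this 2
    _ = d * M ^ 2 := by simp
    _ ≤ (d * M) ^ 2 := by
        have : (1 : ℝ) ≤ d := by exact_mod_cast hd
        nlinarith [sq_nonneg M]

theorem abs_sub_le_dist_toEuclidean (x y : Fin d → ℤ) (i : Fin d) :
    |((x i - y i : ℤ) : ℝ)| ≤ dist (toEuclidean x) (toEuclidean y) := by
  rw [EuclideanSpace.dist_eq]
  refine Real.le_sqrt_of_sq_le ?_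
  have h := Finset.single_le_sum (f := fun i => dist (toEuclidean x i) (toEuclidean y i) ^ 2)
    (fun i _ => sq_nonneg _) (Finset.mem_univ i)
  refine le_trans (le_of_eq ?_) h
  simp [toEuclidean, Real.dist_eq]

theorem one_le_dist_toEuclidean {x y : Fin d → ℤ} (h : x ≠ y) :
    1 ≤ dist (toEuclidean x) (toEuclidean y) := by
  obtain ⟨i, hi⟩ := Function.ne_iff.1 h
  refine le_trans ?_ (abs_sub_le_dist_toEuclidean x y i)
  exact_mod_cast Int.one_le_abs (sub_ne_zero.2 hi)

/-- Coordinatewise the matching expands a difference by at most an additive 2D, which is absorbed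
because distinct lattice points are at distance at least 1. The factor d passes from the sup norm to
the Euclidean norm. -/
theorem bestLip_le_of_transports {N n D : ℕ} (hn : 0 < n) (hnN : n ≤ N) {S : Finset (Fin d → ℤ)}
    (hcard : S.card = n ^ d)
    (hT : Transports D (cellCount N n S) (fun x => if x ∈ grid d n then 1 else 0)) :
    bestLip d n S ≤ d * (2 * D + 1) := by
  obtain ⟨f, hsurj, hf⟩ := exists_matching hcard hT
  refine ((isLeast_bestLip hcard).2 ⟨f, hsurj, rfl⟩).trans
    ((isLeast_lip f).2 ⟨by positivity, fun x y => ?_⟩)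
  by_cases hxy : x = y
  · subst hxy; simp
  have h1 := one_le_dist_toEuclidean (fun h => hxy (Subtype.ext h) : x.1 ≠ y.1)
  rw [mul_assoc]
  refine dist_toEuclidean_le fun i => ?_
  have h2 : |(f x).1 i - (f y).1 i| ≤ 2 * D + |x.1 i - y.1 i| := by
    have e1 := abs_le.1 (hf x i)
    have e2 := abs_le.1 (hf y i)
    have e3 := cell_le_cell_add hn hnN (x.1 i) (y.1 i)
    have e4 := cell_le_cell_add hn hnN (y.1 i) (x.1 i)
    rw [abs_sub_comm] at e4
    rw [abs_le]
    constructor <;> linarith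
  have h3 : |(((f x).1 i - (f y).1 i : ℤ) : ℝ)| ≤ 2 * D + |((x.1 i - y.1 i : ℤ) : ℝ)| := by
    exact_mod_cast h2
  have h4 := abs_sub_le_dist_toEuclidean x.1 y.1 i
  nlinarith

theorem bestLip_nonneg (n : ℕ) (S : Finset (Fin d → ℤ)) : 0 ≤ bestLip d n S := by
  refine Real.sInf_nonneg ?_
  rintro L ⟨f, -, rfl⟩
  exact (isLeast_lip f).1.1

/-- Balanced sets admit a surjection onto the grid with a small Lipschitz constant. -/
theorem IsBalanced.bestLip_le {N n : ℕ} {Λ κ h : ℝ} {S : Finset (Fin d → ℤ)} (hd : 2 ≤ d)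
    (hn : 0 < n) (hnN : n ≤ N) (hSN : S ⊆ grid d N) (hcard : S.card = n ^ d)
    (hΛn : Λ = Real.log n) (hΛ : 1 ≤ Λ) (hκ : 0 < κ) (hΛh : Λ ≤ h) (hhd : Λ ^ 3 ≤ h ^ d)
    (hbig : 16 * κ * 2 ^ d ≤ Λ ^ 2) (hHn : ⌈h⌉₊ + 1 ≤ n)
    (hS : IsBalanced N n (⌈h⌉₊ + 1) (κ * Λ) S) :
    bestLip d n S ≤ d * (2 * (8 + 36 * d + 12 * d * √(12 * κ * 2 ^ d)) + 1) * h := by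
  have hh1 : 1 ≤ h := hΛ.trans hΛh
  have hH2 : 2 ≤ ⌈h⌉₊ + 1 := by
    have : 0 < ⌈h⌉₊ := Nat.ceil_pos.2 (by linarith)
    omega
  have hhH : h ≤ ((⌈h⌉₊ + 1 : ℕ) : ℝ) := by
    push_cast; linarith [Nat.le_ceil h]
  have hHh : ((⌈h⌉₊ + 1 : ℕ) : ℝ) ≤ 3 * h := by
    push_cast; linarith [Nat.ceil_lt_add_one (by linarith : 0 ≤ h)]
  set H := ⌈h⌉₊ + 1
  set W := √(12 * κ * 2 ^ d) * h / Λ with hW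
  have hW0 : 0 ≤ W := by positivity
  -- `IsBalanced.split` gives relative error 4 + 2W, which has to be at most e - 1.
  set e := ⌈5 + 2 * W⌉₊
  have he1 : 5 + 2 * W ≤ e := Nat.le_ceil _
  have he2 : (e : ℝ) ≤ 6 + 2 * W := by
    linarith [Nat.ceil_lt_add_one (by linarith : 0 ≤ 5 + 2 * W)]
  set k := (Nat.log 2 n + 1) * (2 * d) with hk
  have hg : ∀ x, 0 ≤ cellCount N n S x := fun x => by unfold cellCount; positivity
  have hroot : box (fun _ : Fin d => (0 : ℤ)) (fun _ => (n : ℤ)) = grid d n := by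
    ext x
    rw [mem_box, grid, Fintype.mem_piFinset]
    refine forall_congr' fun i => ?_
    rw [Finset.mem_Icc]
    omega
  have hrootN : cellBox N n (fun _ : Fin d => (0 : ℤ)) (fun _ => (n : ℤ)) = grid d N := by
    refine Finset.filter_true_of_mem fun x hx => mem_box.2 fun i => ?_
    have := Finset.mem_Icc.1 (Fintype.mem_piFinset.1 hx i)
    exact cell_mem hn hnN this.1 this.2
  have ht := transports_spread_of_splits hg (n := n) (H := H) (e := e) (by omega)
    (fun a b i hab hside hfat hi hlong => by
      have := hS.split hd hn hnN hH2 (by linarith) hκ (by linarith) hhH hhd hbig hab hside hfat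
        (i := i) (m := a i + (b i - a i) / 2) (by omega) (by omega)
      rw [sum_cellCount_box hSN, sum_cellCount_box hSN]
      refine ⟨this.1, this.2.trans ?_⟩
      gcongr
      linarith)
    k (fun _ => 0) (fun _ => n) (fun _ => ⟨le_rfl, le_rfl⟩) (fun _ => by simpa using hHn)
    (fun _ _ => by omega) (by
      rw [hroot, card_grid]
      have h1 : n ≤ 2 ^ (Nat.log 2 n + 1) := (Nat.lt_pow_succ_log_self (by norm_num) n).le
      have h2 : (n ^ d) ^ 2 ≤ 2 ^ k := by
        rw [hk, pow_mul, ← pow_mul, mul_comm d 2]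
        exact Nat.pow_le_pow_left h1 _
      exact_mod_cast h2)
  have hfun1 : (fun x => if x ∈ box (fun _ : Fin d => (0 : ℤ)) (fun _ => (n : ℤ)) then
      cellCount N n S x else 0) = cellCount N n S := by
    funext x
    split_ifs with hx
    · rfl
    · symm
      rw [cellCount, Nat.cast_eq_zero, Finset.card_eq_zero, Finset.filter_eq_empty_iff]
      rintro y hy rfl
      refine hx (mem_box.2 fun i => ?_)
      have := Finset.mem_Icc.1 (Fintype.mem_piFinset.1 (hSN hy) i)
      exact cell_mem hn hnN this.1 this.2
  have hfun2 : spread (cellCount N n S) (box (fun _ : Fin d => (0 : ℤ)) (fun _ => (n : ℤ))) =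
      fun x => if x ∈ grid d n then 1 else 0 := by
    funext x
    rw [spread, sum_cellCount_box hSN, hrootN, hroot, Finset.inter_eq_left.2 hSN, hcard, card_grid,
      div_self (Nat.cast_ne_zero.2 (pow_pos hn d).ne')]
  rw [hfun1, hfun2] at ht
  refine (bestLip_le_of_transports hn hnN hcard ht).trans ?_
  have hkΛ : (k : ℝ) ≤ 6 * d * Λ := by
    have h1 : (Nat.log 2 n : ℝ) * Real.log 2 ≤ Λ := by
      rw [hΛn, ← Real.log_pow]
      refine Real.log_le_log (by positivity) ?_
      exact_mod_cast Nat.pow_log_le_self 2 hn.ne'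
    have h2 := Real.log_two_gt_d9
    have h3 : (Nat.log 2 n : ℝ) ≤ 2 * Λ := by
      have : (0 : ℝ) ≤ Nat.log 2 n := by positivity
      nlinarith
    rw [hk]
    push_cast
    have : (0 : ℝ) ≤ d := by positivity
    nlinarith
  -- Depth O(Λ) times W = O(h/Λ) gives O(h); the constant part of e gives O(Λ), which is where Λ ≤ h
  -- is used.
  have hke : (k : ℝ) * e ≤ (36 * d + 12 * d * √(12 * κ * 2 ^ d)) * h := by
    calc (k : ℝ) * e ≤ (6 * d * Λ) * (6 + 2 * W) := by gcongr
      _ = 36 * d * Λ + 12 * d * √(12 * κ * 2 ^ d) * h := by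
        rw [hW]; field_simp; ring
      _ ≤ 36 * d * h + 12 * d * √(12 * κ * 2 ^ d) * h := by gcongr
      _ = _ := by ring
  have hfin : 2 * ((2 * H + 2 + k * e : ℕ) : ℝ) + 1 ≤
      (2 * (8 + 36 * d + 12 * d * √(12 * κ * 2 ^ d)) + 1) * h := by
    push_cast
    linarith
  exact (mul_le_mul_of_nonneg_left hfin (Nat.cast_nonneg d)).trans_eq (mul_assoc _ _ _).symm

/-! ### Random sets are eventually balanced -/

/-- Union bound over at most (n + 1)^(2d) pairs of corners. The deviation t = 2√(κΛM) makes the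
Chernoff exponent t²/(4M) equal to κΛ for every box. -/
theorem card_not_isBalanced_le {N n H : ℕ} {Λ κ h : ℝ} (hn : 0 < n) (hnN : n ≤ N) (hH : 2 ≤ H)
    (hΛ : 0 < Λ) (hκ : 0 < κ) (h0 : 0 ≤ h) (hhH : h ≤ H) (hhd : Λ ^ 3 ≤ h ^ d)
    (hbig : 16 * κ * 2 ^ d ≤ Λ ^ 2)
    [DecidablePred fun S : Finset (Fin d → ℤ) => ¬ IsBalanced N n H (κ * Λ) S] :
    ((((grid d N).powersetCard (n ^ d)).filter fun S => ¬ IsBalanced N n H (κ * Λ) S).card : ℝ) ≤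
      ((n : ℝ) + 1) ^ (2 * d) * (2 * Real.exp (-(κ * Λ))) *
        ((grid d N).powersetCard (n ^ d)).card := by
  classical
  have hN : 0 < N := hn.trans_le hnN
  let I : Finset (Fin d → ℤ) := Fintype.piFinset fun _ => Finset.Icc 0 (n : ℤ)
  let J := (I ×ˢ I).filter fun p => ∀ j, (H : ℤ) ≤ p.2 j - p.1 j
  let M : (Fin d → ℤ) × (Fin d → ℤ) → ℝ := fun p => ∏ j, width N n (p.1 j) (p.2 j)
  let B : (Fin d → ℤ) × (Fin d → ℤ) → Finset (Finset (Fin d → ℤ)) := fun p =>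
    ((grid d N).powersetCard (n ^ d)).filter fun S =>
      2 * √(κ * Λ * M p) ≤ |((S ∩ cellBox N n p.1 p.2).card : ℝ) - M p|
  have hmem : ∀ {x : Fin d → ℤ}, x ∈ I ↔ ∀ j, 0 ≤ x j ∧ x j ≤ n := by
    intro x; simp [I]
  have hsub : (((grid d N).powersetCard (n ^ d)).filter fun S =>
      ¬ IsBalanced N n H (κ * Λ) S) ⊆ J.biUnion B := by
    intro S hS
    obtain ⟨hS, hbad⟩ := Finset.mem_filter.1 hS
    simp only [IsBalanced, not_forall, not_le] at hbad
    obtain ⟨a, b, hab, hside, hbad⟩ := hbad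
    refine Finset.mem_biUnion.2 ⟨(a, b), Finset.mem_filter.2 ⟨Finset.mem_product.2
      ⟨hmem.2 fun j => ?_, hmem.2 fun j => ?_⟩, hside⟩, Finset.mem_filter.2 ⟨hS, hbad.le⟩⟩
    · have h1 := hab j; have h2 := hside j; dsimp only; omega
    · have h1 := hab j; have h2 := hside j; dsimp only; omega
  have hB : ∀ p ∈ J, ((B p).card : ℝ) ≤ 2 * Real.exp (-(κ * Λ)) *
      ((grid d N).powersetCard (n ^ d)).card := by
    intro p hp
    obtain ⟨hp, hside⟩ := Finset.mem_filter.1 hp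
    obtain ⟨hp1, hp2⟩ := Finset.mem_product.1 hp
    have hM := prod_width_ge hn hnN hH h0 hhH
      (fun j => ⟨(hmem.1 hp1 j).1, (hmem.1 hp2 j).2⟩) hside
    have hM16 : 16 * (κ * Λ) ≤ M p := by
      refine le_trans ?_ hM
      rw [le_div_iff₀ (by positivity)]
      refine le_trans ?_ hhd
      calc 16 * (κ * Λ) * 2 ^ d = (16 * κ * 2 ^ d) * Λ := by ring
        _ ≤ Λ ^ 2 * Λ := by gcongr
        _ = Λ ^ 3 := by ring
    have hκΛ : 0 < κ * Λ := by positivity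
    have hMpos : 0 < M p := by linarith
    have hC := card_filter_deviation_le (grid d N) (cellBox N n p.1 p.2)
      (k := n ^ d) (m := M p) (t := 2 * √(κ * Λ * M p)) (Finset.filter_subset _ _)
      (by rw [card_grid]; exact Nat.pow_le_pow_left hnN d) (by rw [card_grid]; positivity)
      (card_cellBox N n p.1 p.2).symm hMpos (by positivity)
      (by
        refine mul_le_mul_of_nonneg_left (Real.sqrt_le_iff.2 ⟨hMpos.le, ?_⟩) (by norm_num)
        nlinarith)
    refine hC.trans (le_of_eq ?_)
    rw [mul_pow, Real.sq_sqrt (by positivity), Finset.card_powersetCard]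
    congr 4
    field_simp
    ring
  have hJ : (J.card : ℝ) ≤ ((n : ℝ) + 1) ^ (2 * d) := by
    have h1 : J.card ≤ (n + 1) ^ (2 * d) := by
      refine (Finset.card_filter_le _ _).trans (le_of_eq ?_)
      rw [Finset.card_product, two_mul, pow_add]
      simp [I]
    exact_mod_cast h1
  calc _ ≤ ((J.biUnion B).card : ℝ) := by exact_mod_cast Finset.card_le_card hsub
    _ ≤ ∑ p ∈ J, ((B p).card : ℝ) := by exact_mod_cast Finset.card_biUnion_le
    _ ≤ ∑ _p ∈ J, 2 * Real.exp (-(κ * Λ)) * ((grid d N).powersetCard (n ^ d)).card :=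
        Finset.sum_le_sum hB
    _ = J.card * (2 * Real.exp (-(κ * Λ)) * ((grid d N).powersetCard (n ^ d)).card) := by
        rw [Finset.sum_const, nsmul_eq_mul]
    _ ≤ _ := (mul_le_mul_of_nonneg_right hJ (by positivity)).trans_eq (mul_assoc _ _ _).symm

theorem uniformOn_config_le {N n : ℕ} {P : Finset (Fin d → ℤ) → Prop} [DecidablePred P] {ε : ℝ}
    (hnN : n ≤ N)
    (h : ((((grid d N).powersetCard (n ^ d)).filter P).card : ℝ) ≤
      ε * ((grid d N).powersetCard (n ^ d)).card) :
    (uniformOn Set.univ : Measure (Config d N n)) {S | P S.1} ≤ ENNReal.ofReal ε := by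
  have : MeasurableSingletonClass (Config d N n) := ⟨fun _ => trivial⟩
  let _ : Fintype (Config d N n) := Fintype.ofFinite _
  have hpos : 0 < ((grid d N).powersetCard (n ^ d)).card :=
    Finset.card_pos.2 (Finset.powersetCard_nonempty.2
      (by rw [card_grid]; exact Nat.pow_le_pow_left hnN d))
  have hcard : Fintype.card (Config d N n) = ((grid d N).powersetCard (n ^ d)).card := by
    rw [← Nat.card_eq_fintype_card]
    exact Nat.card_eq_card_toFinset _ |>.trans (by simp [Set.toFinset])
  have hcount : (Finset.univ.filter fun S : Config d N n => P S.1).card ≤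
      (((grid d N).powersetCard (n ^ d)).filter P).card :=
    Finset.card_le_card_of_injOn (fun S => S.1)
      (fun S hS => Finset.mem_filter.2 ⟨S.2, (Finset.mem_filter.1 hS).2⟩)
      Subtype.val_injective.injOn
  rw [uniformOn_univ, Measure.count_apply_finite _ (Set.toFinite _), hcard]
  have : (Set.toFinite {S : Config d N n | P S.1}).toFinset =
      Finset.univ.filter fun S : Config d N n => P S.1 := by ext; simp
  rw [this, ENNReal.div_le_iff (by exact_mod_cast hpos.ne') (by simp),
    ← ENNReal.ofReal_natCast (Finset.card _), ← ENNReal.ofReal_natCast (Finset.card _),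
    ← ENNReal.ofReal_mul' (by positivity)]
  refine ENNReal.ofReal_le_ofReal (le_trans ?_ h)
  exact_mod_cast hcount

theorem seqMeasure_preimage (c : ℕ+ → ℝ) (hc : ∀ n, 1 ≤ c n) (n : ℕ+)
    (A : Set (Config d ⌊c n * ((n : ℕ) : ℝ)⌋₊ n)) :
    seqMeasure d c {S | S n ∈ A} = uniformOn Set.univ A := by
  have h : ∀ n : ℕ+, Nonempty (Config d ⌊c n * ((n : ℕ) : ℝ)⌋₊ n) := by
    intro n
    have hle : (n : ℕ) ^ d ≤ (grid d ⌊c n * ((n : ℕ) : ℝ)⌋₊).card := by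
      rw [card_grid]
      refine Nat.pow_le_pow_left (Nat.le_floor ?_) d
      exact le_mul_of_one_le_left (by positivity) (hc n)
    obtain ⟨S, hS⟩ := Finset.powersetCard_nonempty.2 hle
    exact ⟨⟨S, hS⟩⟩
  exact (measurePreserving_eval_infinitePi (fun n : ℕ+ =>
    (uniformOn Set.univ : Measure (Config d ⌊c n * ((n : ℕ) : ℝ)⌋₊ n))) n).measure_preimage
    (MeasurableSpace.measurableSet_top (s := A)).nullMeasurableSet

theorem eventually_scale_bounds (hd : 2 ≤ d) {q κ : ℝ} (hq : 1 ≤ q) (hqd : 3 / (d : ℝ) < q) :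
    ∀ᶠ n : ℕ in atTop, 1 ≤ Real.log n ∧ Real.log n ≤ Real.log n ^ q ∧
      Real.log n ^ 3 ≤ (Real.log n ^ q) ^ d ∧ 16 * κ * 2 ^ d ≤ Real.log n ^ 2 ∧
      ⌈Real.log n ^ q⌉₊ + 1 ≤ n := by
  have hlog : Tendsto (fun n : ℕ => Real.log n) atTop atTop :=
    Real.tendsto_log_atTop.comp tendsto_natCast_atTop_atTop
  have hlittle := ((isLittleO_log_rpow_rpow_atTop q one_pos).bound
    (by norm_num : (0 : ℝ) < 1 / 2))
  have hlittle' := tendsto_natCast_atTop_atTop.eventually hlittle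
  filter_upwards [hlog.eventually_ge_atTop 1, hlog.eventually_ge_atTop (16 * κ * 2 ^ d), hlittle',
    eventually_ge_atTop 4] with n h1 h2 h3 h4
  have hd0 : (0 : ℝ) < d := by positivity
  have h4R : (4 : ℝ) ≤ n := by exact_mod_cast h4
  refine ⟨h1, Real.self_le_rpow_of_one_le h1 hq, ?_, by nlinarith, ?_⟩
  · rw [← Real.rpow_natCast, ← Real.rpow_natCast, ← Real.rpow_mul (by linarith)]
    refine Real.rpow_le_rpow_of_exponent_le h1 ?_
    rw [div_lt_iff₀ hd0] at hqd
    push_cast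
    linarith
  · have hpos : 0 ≤ Real.log n ^ q := by positivity
    rw [Real.rpow_one, Real.norm_of_nonneg hpos, Real.norm_of_nonneg (by positivity)] at h3
    have h5 := Nat.ceil_lt_add_one hpos
    have h6 : ((⌈Real.log n ^ q⌉₊ + 1 : ℕ) : ℝ) ≤ n := by
      push_cast
      linarith
    exact_mod_cast h6

/-- The choice κ = 2d + 2 makes each failure probability of order n^(-2d-2), so that a summable n⁻²
remains after the union bound. -/
theorem union_bound_le (n : ℕ) (hn : 0 < n) :
    ((n : ℝ) + 1) ^ (2 * d) * (2 * Real.exp (-((2 * d + 2 : ℝ) * Real.log n))) ≤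
      2 * 4 ^ d * (1 / (n : ℝ) ^ 2) := by
  have hnR : (1 : ℝ) ≤ n := by exact_mod_cast hn
  have h1 : Real.exp (-((2 * d + 2 : ℝ) * Real.log n)) = 1 / (n : ℝ) ^ (2 * d + 2) := by
    rw [Real.exp_neg, one_div, show (2 * d + 2 : ℝ) = ((2 * d + 2 : ℕ) : ℝ) by push_cast; ring,
      Real.exp_nat_mul, Real.exp_log (by linarith)]
  rw [h1]
  have h2 : ((n : ℝ) + 1) ^ (2 * d) ≤ 4 ^ d * (n : ℝ) ^ (2 * d) := by
    calc ((n : ℝ) + 1) ^ (2 * d) ≤ (2 * n) ^ (2 * d) := by gcongr; linarith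
      _ = _ := by rw [mul_pow, pow_mul]; norm_num
  calc _ ≤ 4 ^ d * (n : ℝ) ^ (2 * d) * (2 * (1 / (n : ℝ) ^ (2 * d + 2))) := by gcongr
    _ = _ := by
      rw [pow_add]; field_simp

/-- Almost surely, all but finitely many of the sets `S n` are balanced. -/
theorem ae_finite_not_isBalanced (hd : 2 ≤ d) (c : ℕ+ → ℝ) (hc : ∀ n, 1 ≤ c n) {q : ℝ}
    (hq : 1 ≤ q) (hqd : 3 / (d : ℝ) < q) :
    ∀ᵐ S ∂(seqMeasure d c), ∀ᶠ n : ℕ+ in atTop,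
      IsBalanced ⌊c n * ((n : ℕ) : ℝ)⌋₊ n (⌈Real.log (n : ℕ) ^ q⌉₊ + 1)
        ((2 * d + 2 : ℝ) * Real.log (n : ℕ)) (S n).1 := by
  classical
  obtain ⟨n₀, hn₀⟩ := eventually_atTop.1
    (eventually_scale_bounds (κ := 2 * d + 2) hd hq hqd)
  -- Including n₀ ≤ n empties the event for small n, so the bound n⁻² holds up to a constant for all
  -- n and can be summed directly.
  let bad : ℕ+ → Set (SeqSpace d c) := fun n => {S | n₀ ≤ (n : ℕ) ∧
    ¬ IsBalanced ⌊c n * ((n : ℕ) : ℝ)⌋₊ n (⌈Real.log (n : ℕ) ^ q⌉₊ + 1)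
        ((2 * d + 2 : ℝ) * Real.log (n : ℕ)) (S n).1}
  have hbad : ∀ n, seqMeasure d c (bad n) ≤
      ENNReal.ofReal (2 * 4 ^ d * (1 / ((n : ℕ) : ℝ) ^ 2)) := by
    intro n
    by_cases hn : n₀ ≤ (n : ℕ)
    swap
    · simp [bad, hn]
    obtain ⟨h1, h2, h3, h4, h5⟩ := hn₀ n hn
    have hnN : (n : ℕ) ≤ ⌊c n * ((n : ℕ) : ℝ)⌋₊ :=
      Nat.le_floor (le_mul_of_one_le_left (by positivity) (hc n))
    have hset : bad n = {S | S n ∈ {T : Config d ⌊c n * ((n : ℕ) : ℝ)⌋₊ n |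
        ¬ IsBalanced ⌊c n * ((n : ℕ) : ℝ)⌋₊ n (⌈Real.log (n : ℕ) ^ q⌉₊ + 1)
        ((2 * d + 2 : ℝ) * Real.log (n : ℕ)) T.1}} := by
      ext S
      simp [bad, hn]
    rw [hset, seqMeasure_preimage c hc]
    have hpos : 0 < ⌈Real.log (n : ℕ) ^ q⌉₊ := Nat.ceil_pos.2 (by linarith)
    have hceil : Real.log (n : ℕ) ^ q ≤ ((⌈Real.log (n : ℕ) ^ q⌉₊ + 1 : ℕ) : ℝ) := by
      push_cast
      linarith [Nat.le_ceil (Real.log (n : ℕ) ^ q)]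
    have hcount := card_not_isBalanced_le (d := d) (κ := 2 * d + 2) n.pos hnN (by omega)
      (by linarith) (by positivity) (by linarith) hceil h3 h4
    exact (uniformOn_config_le hnN hcount).trans
      (ENNReal.ofReal_le_ofReal (union_bound_le _ n.pos))
  have hsum : ∑' n, seqMeasure d c (bad n) ≠ ⊤ := by
    refine ne_top_of_le_ne_top ?_ (ENNReal.tsum_le_tsum hbad)
    refine Summable.tsum_ofReal_ne_top ?_
    have := (Real.summable_one_div_nat_pow.2 (by norm_num : 1 < 2)).mul_left (2 * 4 ^ d : ℝ)
    exact this.comp_injective PNat.coe_injective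
  -- First Borel–Cantelli lemma: almost surely only finitely many bad events occur.
  filter_upwards [ae_finite_setOfPred_mem hsum] with S hS
  obtain ⟨n₁, hn₁⟩ := hS.bddAbove
  filter_upwards [eventually_gt_atTop n₁, eventually_ge_atTop (⟨n₀ + 1, Nat.succ_pos _⟩ : ℕ+)]
    with n h1 h2
  by_contra h
  refine absurd (hn₁ (show S ∈ bad n from ⟨?_, h⟩)) (not_le.2 h1)
  have : n₀ + 1 ≤ (n : ℕ) := h2
  omega

end RandomGrid

/-! ### Almost sure finiteness of the limsup -/

theorem mainTheorem1 (d : ℕ) (hd : 2 ≤ d) (c : ℕ+ → ℝ) (hc₁ : 1 ≤ c 1)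
    (hc : ∀ n : ℕ+, 2 ≤ n →
      (1 + 2 ^ (d + 7) / Real.logb 2 ((n : ℕ) : ℝ)) ^ (1 / (d : ℝ)) ≤ c n)
    (q : ℝ) (hq : 1 ≤ q) (hqd : 3 / (d : ℝ) < q) :
    RandomGrid.seqMeasure d c
      {S : RandomGrid.SeqSpace d c |
        Filter.limsup (fun n : ℕ+ =>
          ((RandomGrid.bestLip d n (S n).1 * (Real.logb 2 ((n : ℕ) : ℝ)) ^ (-q) : ℝ) : EReal))
          Filter.atTop < ⊤} = 1 := by
  have hc1 : ∀ n, 1 ≤ c n := by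
    intro n
    rcases eq_or_ne n 1 with rfl | hn
    · exact hc₁
    · have h2 : 2 ≤ n := by
        have : (n : ℕ) ≠ 1 := fun h => hn (PNat.coe_injective h)
        have := n.pos
        exact (show (2 : ℕ) ≤ (n : ℕ) by omega)
      refine le_trans (Real.one_le_rpow ?_ (by positivity)) (hc n h2)
      have : 0 ≤ Real.logb 2 ((n : ℕ) : ℝ) :=
        Real.logb_nonneg (by norm_num) (by exact_mod_cast n.pos)
      exact le_add_of_nonneg_right (by positivity)
  have := RandomGrid.isProbabilityMeasure_seqMeasure d c hc1
  rw [← measure_univ (μ := RandomGrid.seqMeasure d c)]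
  -- The event agrees almost everywhere with the whole space, so its measurability need not be
  -- checked.
  refine measure_congr (eventuallyEq_univ.2 ?_)
  have hcoe : Tendsto (fun n : ℕ+ => (n : ℕ)) atTop atTop :=
    tendsto_atTop_atTop.2 fun b => ⟨⟨b + 1, Nat.succ_pos b⟩, fun n hn => by
      have : b + 1 ≤ (n : ℕ) := hn
      omega⟩
  filter_upwards [RandomGrid.ae_finite_not_isBalanced hd c hc1 hq hqd] with S hS
  set κ : ℝ := 2 * d + 2
  refine lt_of_le_of_lt (limsup_le_of_le (a := ((d * (2 * (8 + 36 * d + 12 * d *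
    √(12 * κ * 2 ^ d)) + 1) : ℝ) : EReal)) (by isBoundedDefault) ?_) (EReal.coe_lt_top _)
  filter_upwards [hS, hcoe.eventually (RandomGrid.eventually_scale_bounds (κ := κ) hd hq hqd)]
    with n hbal ⟨h1, h2, h3, h4, h5⟩
  have hnN : (n : ℕ) ≤ ⌊c n * ((n : ℕ) : ℝ)⌋₊ :=
    Nat.le_floor (le_mul_of_one_le_left (by positivity) (hc1 n))
  obtain ⟨hsub, hcard⟩ := Finset.mem_powersetCard.1 (S n).2
  have hle := hbal.bestLip_le hd n.pos hnN hsub hcard rfl h1 (by positivity) h2 h3 h4 h5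
  have hlogpos : 0 < Real.log (n : ℕ) := by linarith
  -- The estimates use the natural logarithm. The binary one is larger, so its power with exponent
  -- -q is smaller, which is the direction needed.
  have hlogb : Real.log (n : ℕ) ≤ Real.logb 2 (n : ℕ) := by
    rw [Real.logb, le_div_iff₀ (Real.log_pos (by norm_num))]
    have := Real.log_two_lt_d9
    nlinarith
  have hpow : Real.logb 2 ((n : ℕ) : ℝ) ^ (-q) ≤ Real.log (n : ℕ) ^ (-q) :=
    Real.rpow_le_rpow_of_nonpos hlogpos hlogb (by linarith)
  refine EReal.coe_le_coe_iff.2 ?_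
  calc _ ≤ RandomGrid.bestLip d n (S n).1 * Real.log (n : ℕ) ^ (-q) :=
        mul_le_mul_of_nonneg_left hpow (RandomGrid.bestLip_nonneg _ _)
    _ ≤ d * (2 * (8 + 36 * d + 12 * d * √(12 * κ * 2 ^ d)) + 1) * Real.log (n : ℕ) ^ q *
        Real.log (n : ℕ) ^ (-q) := by gcongr
    _ = _ := by
      rw [mul_assoc, ← Real.rpow_add hlogpos, add_neg_cancel, Real.rpow_zero, mul_one]
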